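/- Let $\mathcal A_u(B_{c_0})$ be the Banach algebra (with the supremum norm) of uniformly continuous holomorphic functions on the open unit ball $B_{c_0}$ of complex $c_0$, and let $\mathcal M$ be its spectrum, i.e. the set of nonzero continuous homomorphisms $\mathcal A_u(B_{c_0})\to\mathbb C$. For $\varphi,\psi\in\mathcal M$ put $\rho(\varphi,\psi)=\sup\{|\varphi(f)|: \|f\|\le 1,\ \psi(f)=0\}$; the Gleason part of $\varphi$ is $\mathcal{GP}(\varphi)=\{\psi\in\mathcal M:\rho(\varphi,\psi)<1\}$, and the Gleason metric is $\|\varphi-\psi\|$, the norm being that of the dual of the algebra. Every $f\in\mathcal A_u(B_{c_0})$ has a canonical extension $\tilde f$ to the closed unit ball $\overline B_{\ell_\infty}$ of $\ell_\infty=c_0^{**}$: on the open ball $B_{\ell_\infty}$ it is the sum of the Aron–Berner extensions of the Taylor polynomials of $f$ at $0$, and it is uniformly continuous on $\overline B_{\ell_\infty}$. Then $\delta_z(f)=\tilde f(z)$ defines an element $\delta_z\in\mathcal M$ for each $z\in\overline B_{\ell_\infty}$. The open ball $B_{\ell_\infty}$ carries the Gleason metric $\|\delta_u-\delta_v\|$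 of $\mathcal M$, and the polydisc $\mathbb D^k$ (the open unit ball of $\mathbb C^k$ with the maximum norm) carries the Gleason metric of evaluations on $\mathcal A_u(\mathbb D^k)$. Let $z=(z_n)\in\overline B_{\ell_\infty}$, let $\mathbb N_1=\{n:|z_n|=1\}$, and let $\mathbb N\setminus\mathbb N_1=\mathbb N_2\cup\mathbb N_3$ be a disjoint union with $\sup_{n\in\mathbb N_2}|z_n|<1$ (or $\mathbb N_2=\varnothing$) and $\sup_{n\in\mathbb N_3}|z_n|=1$ (or $\mathbb N_3=\varnothing$). Then: (i) If $\mathbb N=\mathbb N_2$, then $z\in B_{\ell_\infty}$ and $\mathcal{GP}(\delta_z)=\mathcal{GP}(\delta_0)=\{\delta_w: w\in B_{\ell_\infty}\}$, and $w\mapsto\delta_w$ is injective on $B_{\ell_\infty}$. (ii) If $\mathbb N=\mathbb N_1$, then $z\in\mathbb T^{\mathbb N}$ and $\mathcal{GP}(\delta_z)=\{\delta_z\}$. (iii) If $\mathbb N_3=\varnothing$ and $\mathbb N_1,\mathbb N_2\ne\varnothing$, then $\mathcal{GP}(\delta_z)=\{\delta_w: w\in\overline B_{\ell_\infty},\ w_n=z_n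 \text{ for } n\in\mathbb N_1,\ \sup_{n\in\mathbb N_2}|w_n|<1\}$. If $\#\mathbb N_2=k$, then replacing the coordinates of $z$ in $\mathbb N_2$ by those of $u\in\mathbb D^k$ (for an enumeration of $\mathbb N_2$) gives a bijection from $\mathbb D^k$ onto $\mathcal{GP}(\delta_z)$ that is isometric for the Gleason metrics. If $\mathbb N_2$ is infinite, the same procedure gives a bijection from $B_{\ell_\infty}$ onto $\mathcal{GP}(\delta_z)$ that is isometric for the Gleason metrics. (iv) If $\mathbb N_3$ is infinite and $\mathbb N_2=\varnothing$, then for every $k\in\mathbb N$ replacing $k$ suitable coordinates of $z$ in $\mathbb N_3$ by those of $u\in\mathbb D^k$ gives an injection of $\mathbb D^k$ into $\mathcal{GP}(\delta_z)$ that is isometric for the Gleason metrics. There is also an injection of $B_{\ell_\infty}$ into $\mathcal{GP}(\delta_z)$ that is continuous from the norm topology to the topology of the Gleason metric. (v) If $\mathbb N_2$ and $\mathbb N_3$ are both infinite, then replacing the coordinates of $z$ in $\mathbb N_2$ by those of $u\in B_{\ell_\infty}$ (for an enumeration of $\mathbb N_2$) gives an injection of $B_{\ell_\infty}$ into $\mathcal{GP}(\delta_z)$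 that is isometric for the Gleason metrics. Moreover, every $z\in\overline B_{\ell_\infty}$ admits a splitting $\mathbb N_2,\mathbb N_3$ as above for which the hypothesis of one of (i)–(v) holds. -/

import Mathlib

open Metric Set Filter Topology WeakDual
open scoped ENNReal ZeroAtInfty BoundedContinuousFunction

noncomputable section

/-! ### The algebra of uniformly continuous holomorphic functions on the open unit ball -/

section Algebra

variable (X : Type*) [NormedAddCommGroup X] [NormedSpace ℂ X]

/-- Extension by zero of a function on the open unit ball of `X`. -/
def zeroExt {X : Type*} [NormedAddCommGroup X] (f : ball (0 : X) 1 → ℂ) : X → ℂ :=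
  open Classical in fun x => if h : x ∈ ball (0 : X) 1 then f ⟨x, h⟩ else 0

/-- A function on the open unit ball is holomorphic if it is complex analytic: near every point of
the ball it is the sum of a convergent power series. -/
def IsHolomorphic {X : Type*} [NormedAddCommGroup X] [NormedSpace ℂ X]
    (f : ball (0 : X) 1 → ℂ) : Prop :=
  AnalyticOnNhd ℂ (zeroExt f) (ball (0 : X) 1)

theorem zeroExt_eq {X : Type*} [NormedAddCommGroup X] (f : ball (0 : X) 1 → ℂ) {x : X}
    (h : x ∈ ball (0 : X) 1) : zeroExt f x = f ⟨x, h⟩ := by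
  simp only [zeroExt, dif_pos h]

/-- `𝒜_u(B_X)` with the supremum norm. (A uniformly continuous function on a ball is bounded, so
working inside the bounded continuous functions is no restriction.) -/
def Au : Subalgebra ℂ (ball (0 : X) 1 →ᵇ ℂ) where
  carrier := {f | UniformContinuous f ∧ IsHolomorphic f}
  mul_mem' := by
    rintro f g ⟨hf, hf'⟩ ⟨hg, hg'⟩
    refine ⟨?_, ?_⟩
    · rw [Metric.uniformContinuous_iff] at hf hg ⊢
      intro ε hε
      have hM : 0 < ‖f‖ + ‖g‖ + 1 := by positivity
      obtain ⟨d₁, hd₁, h₁⟩ := hf (ε / (‖f‖ + ‖g‖ + 1)) (by positivity)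
      obtain ⟨d₂, hd₂, h₂⟩ := hg (ε / (‖f‖ + ‖g‖ + 1)) (by positivity)
      refine ⟨min d₁ d₂, lt_min hd₁ hd₂, ?_⟩
      intro a b hab
      have e₁ := h₁ (lt_of_lt_of_le hab (min_le_left _ _))
      have e₂ := h₂ (lt_of_lt_of_le hab (min_le_right _ _))
      rw [dist_eq_norm] at e₁ e₂ ⊢
      have key : (f * g) a - (f * g) b = f a * (g a - g b) + (f a - f b) * g b := by
        simp only [BoundedContinuousFunction.mul_apply]; ring
      rw [key]
      have n₁ := f.norm_coe_le_norm a
      have n₂ := g.norm_coe_le_norm b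
      calc ‖f a * (g a - g b) + (f a - f b) * g b‖
          ≤ ‖f a‖ * ‖g a - g b‖ + ‖f a - f b‖ * ‖g b‖ := by
            refine (norm_add_le _ _).trans ?_
            rw [norm_mul, norm_mul]
        _ ≤ ‖f‖ * (ε / (‖f‖ + ‖g‖ + 1)) + (ε / (‖f‖ + ‖g‖ + 1)) * ‖g‖ := by
            gcongr
        _ < ε := by
            have : 0 < ε / (‖f‖ + ‖g‖ + 1) := by positivity
            have h3 : ε / (‖f‖ + ‖g‖ + 1) * (‖f‖ + ‖g‖ + 1) = ε := by field_simp
            nlinarith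
    · refine (hf'.mul hg').congr isOpen_ball fun x hx => ?_
      simp [zeroExt_eq _ hx]
  add_mem' := by
    rintro f g ⟨hf, hf'⟩ ⟨hg, hg'⟩
    refine ⟨hf.add hg, (hf'.add hg').congr isOpen_ball fun x hx => ?_⟩
    simp [zeroExt_eq _ hx]
  algebraMap_mem' := by
    intro c
    refine ⟨uniformContinuous_const, (analyticOnNhd_const (v := c)).congr isOpen_ball fun x hx => ?_⟩
    rw [zeroExt_eq _ hx]
    rfl

/-- Evaluation at a point of the open unit ball of `X`, as an element of the spectrum of
`𝒜_u(B_X)`. -/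
def evalChar (x : ball (0 : X) 1) : characterSpace ℂ (Au X) :=
  ⟨StrongDual.toWeakDual
      ((BoundedContinuousFunction.evalCLM ℂ x).comp (Au X).toSubmodule.subtypeL), by
    constructor
    · intro h
      have h1 := DFunLike.congr_fun h (1 : Au X)
      exact one_ne_zero (α := ℂ) h1
    · intro f g
      rfl⟩

end Algebra

/-! ### Gleason parts -/

section Gleason

variable {A : Type*} [NormedRing A] [NormedAlgebra ℂ A]

/-- The pseudo-hyperbolic distance on the spectrum. -/
def pseudoHyp (φ ψ : characterSpace ℂ A) : ℝ :=
  sSup {t : ℝ | ∃ f : A, ‖f‖ ≤ 1 ∧ ψ f = 0 ∧ t = ‖φ f‖}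

/-- The Gleason part of `φ`. -/
def gleasonPart (φ : characterSpace ℂ A) : Set (characterSpace ℂ A) :=
  {ψ | pseudoHyp φ ψ < 1}

/-- A character regarded as an element of the normed dual. -/
def toDual (φ : characterSpace ℂ A) : StrongDual ℂ A :=
  WeakDual.toStrongDual (φ : WeakDual ℂ A)

/-- The Gleason metric on the spectrum: the distance of the norm of the dual. -/
def gleasonDist (φ ψ : characterSpace ℂ A) : ℝ :=
  ‖toDual φ - toDual ψ‖

end Gleason

/-! ### The canonical extension to the bidual -/

section Extension

variable {X : Type*} [NormedAddCommGroup X] [NormedSpace ℂ X]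

/-- For `ζ` in the bidual of `X`, the value at `(ζ, …, ζ)` of the Aron–Berner extension of a
continuous `m`-linear form `a` on `X`. The variables are extended one at a time: the value for an
`(m+1)`-linear form `a` is obtained by applying `ζ` to the functional that sends `x` to the value
for the `m`-linear form `a (x, ⋯)`. -/
def aronBerner (ζ : StrongDual ℂ (StrongDual ℂ X)) :
    (m : ℕ) → StrongDual ℂ (ContinuousMultilinearMap ℂ (fun _ : Fin m => X) ℂ)
  | 0 => ContinuousMultilinearMap.apply ℂ (fun _ : Fin 0 => X) ℂ 0
  | m + 1 =>
    (ζ.comp (ContinuousLinearMap.compL ℂ X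
        (ContinuousMultilinearMap ℂ (fun _ : Fin m => X) ℂ) ℂ (aronBerner ζ m))).comp
      (continuousMultilinearCurryLeftEquiv ℂ (fun _ : Fin (m + 1) => X)
        ℂ).toContinuousLinearEquiv.toContinuousLinearMap

theorem aronBerner_succ (ζ : StrongDual ℂ (StrongDual ℂ X)) (m : ℕ)
    (a : ContinuousMultilinearMap ℂ (fun _ : Fin (m + 1) => X) ℂ) :
    aronBerner ζ (m + 1) a = ζ ((aronBerner ζ m).comp a.curryLeft) := rfl

/-- The extension to the bidual, at the point `ζ`, of the `m`-th Taylor polynomial (at the origin)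
of a function on the unit ball. -/
def taylorExt (f : ball (0 : X) 1 → ℂ) (ζ : StrongDual ℂ (StrongDual ℂ X)) (m : ℕ) : ℂ :=
  (Nat.factorial m : ℂ)⁻¹ * aronBerner ζ m (iteratedFDeriv ℂ m (zeroExt f) 0)

end Extension

/-! ### Sequence spaces -/

/-- The Banach space `c₀` of complex null sequences. -/
abbrev CZero : Type := C₀(ℕ, ℂ)

/-- The Banach space `ℓ_∞` of bounded complex sequences. -/
abbrev LInf : Type := lp (fun _ : ℕ => ℂ) ∞

/-- The unit vectors of `c₀`. -/
def unitVec (n : ℕ) : CZero where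
  toFun := Pi.single n 1
  continuous_toFun := continuous_of_discreteTopology
  zero_at_infty' := by
    rw [Filter.cocompact_eq_cofinite]
    refine tendsto_const_nhds.congr' ?_
    have : {n}ᶜ ∈ (Filter.cofinite : Filter ℕ) := (Set.finite_singleton n).compl_mem_cofinite
    filter_upwards [this] with k hk
    rw [Pi.single_eq_of_ne hk]

theorem sum_norm_unitVec_le (φ : StrongDual ℂ CZero) (s : Finset ℕ) :
    ∑ n ∈ s, ‖φ (unitVec n)‖ ≤ ‖φ‖ := by
  let c : ℕ → ℂ := fun n => star (φ (unitVec n)) / (‖φ (unitVec n)‖ : ℂ)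
  have hc : ∀ n, ‖c n‖ ≤ 1 := by
    intro n
    simp only [c, norm_div, norm_star, Complex.norm_real, norm_norm]
    exact div_self_le_one _
  have hcφ : ∀ n, c n * φ (unitVec n) = (‖φ (unitVec n)‖ : ℂ) := by
    intro n
    by_cases h : φ (unitVec n) = 0
    · simp [c, h]
    · have h' : (‖φ (unitVec n)‖ : ℂ) ≠ 0 := by simpa using h
      have := Complex.conj_mul' (φ (unitVec n))
      simp only [c, Complex.star_def, div_mul_eq_mul_div]
      rw [this, sq, mul_div_assoc, div_self h', mul_one]
  have hx : ‖∑ n ∈ s, c n • unitVec n‖ ≤ 1 := by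
    rw [← ZeroAtInftyContinuousMap.norm_toBCF_eq_norm,
      BoundedContinuousFunction.norm_le zero_le_one]
    intro k
    have : (∑ n ∈ s, c n • unitVec n).toBCF k = ∑ n ∈ s, c n * (Pi.single n (1 : ℂ) : ℕ → ℂ) k := by
      change (∑ n ∈ s, c n • unitVec n) k = _
      induction s using Finset.cons_induction with
      | empty => simp
      | cons a s ha ih =>
        rw [Finset.sum_cons, Finset.sum_cons, ZeroAtInftyContinuousMap.add_apply, ih]
        rfl
    rw [this]
    simp only [Pi.single_apply, mul_ite, mul_one, mul_zero, Finset.sum_ite_eq]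
    split_ifs
    · exact hc k
    · simp
  have h1 : φ (∑ n ∈ s, c n • unitVec n) = ((∑ n ∈ s, ‖φ (unitVec n)‖ : ℝ) : ℂ) := by
    rw [map_sum]
    push_cast
    exact Finset.sum_congr rfl fun n _ => by rw [map_smul, smul_eq_mul, hcφ]
  have h2 : ‖((∑ n ∈ s, ‖φ (unitVec n)‖ : ℝ) : ℂ)‖ = ∑ n ∈ s, ‖φ (unitVec n)‖ := by
    rw [Complex.norm_real, Real.norm_of_nonneg (Finset.sum_nonneg fun _ _ => norm_nonneg _)]
  rw [← h2, ← h1]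
  exact (φ.le_opNorm _).trans (mul_le_of_le_one_right (norm_nonneg _) hx)

theorem summable_norm_unitVec (φ : StrongDual ℂ CZero) :
    Summable fun n => ‖φ (unitVec n)‖ :=
  summable_of_sum_le (fun _ => norm_nonneg _) (sum_norm_unitVec_le φ)

theorem norm_mul_unitVec_le (z : LInf) (φ : StrongDual ℂ CZero) (n : ℕ) :
    ‖z n * φ (unitVec n)‖ ≤ ‖z‖ * ‖φ (unitVec n)‖ := by
  rw [norm_mul]
  exact mul_le_mul_of_nonneg_right (lp.norm_apply_le_norm ENNReal.top_ne_zero z n) (norm_nonneg _)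

theorem summable_mul_unitVec (z : LInf) (φ : StrongDual ℂ CZero) :
    Summable fun n => z n * φ (unitVec n) :=
  Summable.of_norm_bounded ((summable_norm_unitVec φ).mul_left ‖z‖) (norm_mul_unitVec_le z φ)

/-- The canonical identification of `ℓ_∞` with the bidual of `c₀`: the sequence `z` acts on the
functional `φ` as `∑ₙ zₙ φ(eₙ)`. -/
def toBidual (z : LInf) : StrongDual ℂ (StrongDual ℂ CZero) :=
  LinearMap.mkContinuous
    { toFun := fun φ : StrongDual ℂ CZero => ∑' n, z n * φ (unitVec n)
      map_add' := fun φ ψ => by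
        rw [← (summable_mul_unitVec z φ).tsum_add (summable_mul_unitVec z ψ)]
        exact tsum_congr fun n => by rw [_root_.add_apply, mul_add]
      map_smul' := fun c φ => by
        rw [RingHom.id_apply, smul_eq_mul, ← tsum_mul_left]
        exact tsum_congr fun n => by
          rw [_root_.smul_apply, smul_eq_mul]; ring }
    ‖z‖
    (fun φ => by
      have hs := (summable_norm_unitVec φ).mul_left ‖z‖
      refine (tsum_of_norm_bounded hs.hasSum (norm_mul_unitVec_le z φ)).trans ?_
      rw [tsum_mul_left]
      exact mul_le_mul_of_nonneg_left
        ((summable_norm_unitVec φ).tsum_le_of_sum_le (sum_norm_unitVec_le φ)) (norm_nonneg _))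

/-! ### Point evaluations at the closed ball of `ℓ_∞` -/

/-- The spectrum of `𝒜_u(B_{c₀})`. -/
abbrev SpecC0 : Type := characterSpace ℂ (Au CZero)

/-- The closed unit ball of `ℓ_∞`. -/
abbrev ClosedBallLInf : Type := closedBall (0 : LInf) 1

/-- The open unit ball of `ℓ_∞`. -/
abbrev OpenBallLInf : Type := ball (0 : LInf) 1

/-- The open polydisc `𝔻ᵏ`, that is, the open unit ball of `ℂᵏ` with the maximum norm. -/
abbrev Polydisc (k : ℕ) : Type := ball (0 : Fin k → ℂ) 1

/-- A point of the open ball of `ℓ_∞` as a point of the closed ball. -/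
def OpenBallLInf.toClosed (w : OpenBallLInf) : ClosedBallLInf :=
  ⟨w.1, ball_subset_closedBall w.2⟩

/-- `δ z` is, for each `z` in the closed unit ball of `ℓ_∞`, the character `f ↦ f̃(z)` of
`𝒜_u(B_{c₀})`, where `f̃` is the canonical extension of `f`: inside the open unit ball `f̃` is the
sum of the Aron–Berner extensions of the Taylor polynomials of `f`, and `f̃` is uniformly continuous
up to the closed unit ball. These two conditions determine `δ`. -/
def IsPointEvaluation (δ : ClosedBallLInf → SpecC0) : Prop :=
  ∀ f : Au CZero,
    (UniformContinuous fun z : ClosedBallLInf => δ z f) ∧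
    ∀ w : OpenBallLInf, HasSum (taylorExt f.1 (toBidual w.1)) (δ w.toClosed f)

/-! ### Splitting the coordinates -/

/-- The set `ℕ₁` of the coordinates of modulus one. -/
def unimodularIdx (z : ClosedBallLInf) : Set ℕ := {n | ‖z.1 n‖ = 1}

/-- `N₂` and `N₃` are disjoint with union the complement of `ℕ₁`, the supremum of `|zₙ|` over `N₂`
is smaller than one (or `N₂` is empty), and the supremum of `|zₙ|` over `N₃` is one (or `N₃` is
empty). -/
structure IsSplitting (z : ClosedBallLInf) (N₂ N₃ : Set ℕ) : Prop where
  disjoint : Disjoint N₂ N₃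
  union : N₂ ∪ N₃ = (unimodularIdx z)ᶜ
  sup_lt : ∃ r : ℝ, r < 1 ∧ ∀ n ∈ N₂, ‖z.1 n‖ ≤ r
  sup_eq : N₃.Nonempty → IsLUB ((fun n => ‖z.1 n‖) '' N₃) 1

end

/-!
By averaging over roots of unity, an `m`-linear form `a` on `c₀` satisfies
`‖a ∘ P‖ + ‖a ∘ (1 - P)‖ ≤ ‖a‖` for every coordinate projection `P`. Hence every form is a limit of
linear combinations of products of coordinate functionals, and the polynomials in the coordinates
are dense in `𝒜_u(B_{c₀})`. A character is therefore determined by its coordinates, and the spectrum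
is the closed ball of `ℓ_∞` with the topology of coordinatewise convergence. By the Schwarz lemma,
applied to discs that are given by one Möbius function in each coordinate, `ρ(δ_z, δ_w) ≤ r < 1`
holds if and only if `|z_n - w_n| ≤ r |1 - conj(w_n) z_n|` for all `n`, which determines the Gleason
parts. The Gleason metric can be tested on polynomials in the coordinates, and on these the
coordinates that are kept fixed act as constants, so that replacing the others is isometric.
-/

noncomputable section

section Bases

variable {X : Type*} [NormedAddCommGroup X] [NormedSpace ℂ X]

/-- The vectors `e` and the coordinate functionals `ℓ` identify `X` with a space of null sequences
that carries the supremum norm and contains all finitely supported sequences. -/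
structure IsCZeroBasis (e : ℕ → X) (ℓ : ℕ → StrongDual ℂ X) : Prop where
  coord_unit : ∀ i j, ℓ i (e j) = if i = j then 1 else 0
  norm_coord_le : ∀ i x, ‖ℓ i x‖ ≤ ‖x‖
  norm_le : ∀ (x : X) (C : ℝ), 0 ≤ C → (∀ i, ‖ℓ i x‖ ≤ C) → ‖x‖ ≤ C
  tendsto_coord : ∀ x, Tendsto (fun i => ℓ i x) atTop (𝓝 0)

/-- The vector whose first `n` coordinates are those of the sequence `z` and whose other
coordinates vanish. -/
def seqTrunc (e : ℕ → X) (n : ℕ) (z : ℕ → ℂ) : X := ∑ i ∈ Finset.range n, z i • e i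

/-- The projection onto the span of the first `n` basis vectors. -/
def basisProj (e : ℕ → X) (ℓ : ℕ → StrongDual ℂ X) (n : ℕ) : X →L[ℂ] X :=
  ∑ i ∈ Finset.range n, (ℓ i).smulRight (e i)

theorem basisProj_apply (e : ℕ → X) (ℓ : ℕ → StrongDual ℂ X) (n : ℕ) (x : X) :
    basisProj e ℓ n x = ∑ i ∈ Finset.range n, ℓ i x • e i := by
  simp [basisProj]

variable {e : ℕ → X} {ℓ : ℕ → StrongDual ℂ X}

namespace IsCZeroBasis

theorem ext (H : IsCZeroBasis e ℓ) {x y : X} (h : ∀ i, ℓ i x = ℓ i y) : x = y := by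
  rw [← sub_eq_zero, ← norm_le_zero_iff]
  exact H.norm_le _ 0 le_rfl fun i => by simp [h i]

theorem coord_seqTrunc (H : IsCZeroBasis e ℓ) (n : ℕ) (z : ℕ → ℂ) (k : ℕ) :
    ℓ k (seqTrunc e n z) = if k < n then z k else 0 := by
  simp [seqTrunc, H.coord_unit]

theorem norm_seqTrunc_le (H : IsCZeroBasis e ℓ) {z : ℕ → ℂ} {C : ℝ} (hC : 0 ≤ C)
    (h : ∀ k, ‖z k‖ ≤ C) (n : ℕ) : ‖seqTrunc e n z‖ ≤ C := by
  refine H.norm_le _ _ hC fun k => ?_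
  rw [H.coord_seqTrunc]
  split_ifs
  exacts [h k, norm_zero.trans_le hC]

theorem tendsto_coord_seqTrunc (H : IsCZeroBasis e ℓ) (z : ℕ → ℂ) (k : ℕ) :
    Tendsto (fun n => ℓ k (seqTrunc e n z)) atTop (𝓝 (z k)) :=
  tendsto_const_nhds.congr' <| (eventually_gt_atTop k).mono fun n hn => by
    simp only [H.coord_seqTrunc, if_pos hn]

theorem coord_basisProj (H : IsCZeroBasis e ℓ) (n : ℕ) (x : X) (k : ℕ) :
    ℓ k (basisProj e ℓ n x) = if k < n then ℓ k x else 0 := by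
  rw [basisProj_apply]
  exact H.coord_seqTrunc n (fun i => ℓ i x) k

theorem tendsto_basisProj (H : IsCZeroBasis e ℓ) (x : X) :
    Tendsto (fun n => basisProj e ℓ n x) atTop (𝓝 x) := by
  rw [Metric.tendsto_atTop]
  intro ε hε
  obtain ⟨N, hN⟩ := Metric.tendsto_atTop.1 (H.tendsto_coord x) (ε / 2) (half_pos hε)
  refine ⟨N, fun n hn => (dist_eq_norm _ _).trans_lt ?_⟩
  refine lt_of_le_of_lt (H.norm_le _ _ (half_pos hε).le fun k => ?_) (half_lt_self hε)
  rw [map_sub, H.coord_basisProj]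
  split_ifs with hk
  · simpa using (half_pos hε).le
  · simpa using (hN k (hn.trans (not_lt.1 hk))).le

theorem isMprojection_basisProj (H : IsCZeroBasis e ℓ) (n : ℕ) :
    IsMprojection X (basisProj e ℓ n) where
  proj := by
    ext x
    refine H.ext fun k => ?_
    simp only [mul_apply_eq_comp, H.coord_basisProj]
    split_ifs <;> rfl
  Mnorm x := by
    have hcompl : ∀ k, ℓ k ((1 - basisProj e ℓ n) • x) = if k < n then 0 else ℓ k x := fun k => by
      rw [sub_smul, one_smul, map_sub, ContinuousLinearMap.smul_def, H.coord_basisProj]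
      split_ifs <;> simp
    refine le_antisymm (H.norm_le _ _ (le_max_of_le_left (norm_nonneg _)) fun k => ?_)
      (max_le ?_ ?_)
    · by_cases hk : k < n
      · refine le_max_of_le_left ((H.norm_coord_le k _).trans' ?_)
        rw [ContinuousLinearMap.smul_def, H.coord_basisProj, if_pos hk]
      · refine le_max_of_le_right ((H.norm_coord_le k _).trans' ?_)
        rw [hcompl, if_neg hk]
    · refine H.norm_le _ _ (norm_nonneg x) fun k => ?_
      rw [ContinuousLinearMap.smul_def, H.coord_basisProj]
      split_ifs
      exacts [H.norm_coord_le k x, norm_zero.trans_le (norm_nonneg x)]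
    · refine H.norm_le _ _ (norm_nonneg x) fun k => ?_
      rw [hcompl]
      split_ifs
      exacts [norm_zero.trans_le (norm_nonneg x), H.norm_coord_le k x]

end IsCZeroBasis

end Bases

section MultilinearForms

variable {X : Type*} [NormedAddCommGroup X] [NormedSpace ℂ X]

/-- The space of continuous `m`-linear forms on `X`. -/
abbrev MForm (X : Type*) [NormedAddCommGroup X] [NormedSpace ℂ X] (m : ℕ) : Type _ :=
  ContinuousMultilinearMap ℂ (fun _ : Fin m => X) ℂ

namespace MForm

variable {m : ℕ}

/-- The multilinear form `(x₁, …, xₘ) ↦ ∏ₖ ℓ_{iₖ}(xₖ)`. -/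
def monomial (ℓ : ℕ → StrongDual ℂ X) (i : Fin m → ℕ) : MForm X m :=
  (ContinuousMultilinearMap.mkPiAlgebra ℂ (Fin m) ℂ).compContinuousLinearMap fun k => ℓ (i k)

theorem monomial_apply (ℓ : ℕ → StrongDual ℂ X) (i : Fin m → ℕ) (x : Fin m → X) :
    monomial ℓ i x = ∏ k, ℓ (i k) (x k) := by
  simp [monomial]

/-- The form obtained from `a` by applying `Q` to the variables in `s`. -/
def compOn (a : MForm X m) (Q : X →L[ℂ] X) (s : Finset (Fin m)) : MForm X m :=
  a.compContinuousLinearMap fun k => if k ∈ s then Q else .id ℂ X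

theorem compOn_apply (a : MForm X m) (Q : X →L[ℂ] X) (s : Finset (Fin m)) (x : Fin m → X) :
    a.compOn Q s x = a fun k => if k ∈ s then Q (x k) else x k := by
  rw [compOn, ContinuousMultilinearMap.compContinuousLinearMap_apply]
  congr 1 with k
  split_ifs <;> rfl

theorem compOn_singleton_apply (a : MForm X m) (Q : X →L[ℂ] X) (p : Fin m) (x : Fin m → X) :
    a.compOn Q {p} x = a (Function.update x p (Q (x p))) := by
  rw [compOn_apply]
  congr 1 with k
  rcases eq_or_ne k p with rfl | hk <;> simp [*]

theorem compOn_one_sub_singleton (a : MForm X m) (Q : X →L[ℂ] X) (p : Fin m) :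
    a.compOn (1 - Q) {p} = a - a.compOn Q {p} := by
  ext x
  rw [_root_.sub_apply, compOn_singleton_apply, compOn_singleton_apply, _root_.sub_apply,
    one_apply_eq_self, a.map_update_sub, Function.update_eq_self]

theorem compOn_insert (a : MForm X m) (Q : X →L[ℂ] X) {p : Fin m} {s : Finset (Fin m)}
    (hp : p ∉ s) : a.compOn Q (insert p s) = (a.compOn Q s).compOn Q {p} := by
  ext x
  simp only [compOn_apply]
  congr 1 with k
  rcases eq_or_ne k p with rfl | hk <;> simp [*]

theorem norm_le_of_forall_norm_le_one {a : MForm X m} {C : ℝ}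
    (h : ∀ x : Fin m → X, (∀ k, ‖x k‖ ≤ 1) → ‖a x‖ ≤ C) : ‖a‖ ≤ C := by
  have hC : 0 ≤ C := (norm_nonneg _).trans (h 0 fun k => by simp)
  refine a.opNorm_le_bound hC fun x => ?_
  have hx : x = fun k => (‖x k‖ : ℂ) • ((‖x k‖⁻¹ : ℝ) : ℂ) • x k := by
    funext k
    rcases eq_or_ne (x k) 0 with hk | hk
    · simp [hk]
    · have : (‖x k‖ : ℂ) ≠ 0 := by simpa using hk
      rw [smul_smul, Complex.ofReal_inv, mul_inv_cancel₀ this, one_smul]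
  rw [hx, a.map_smul_univ, ← hx, norm_smul, mul_comm]
  have hunit : ‖a fun k => ((‖x k‖⁻¹ : ℝ) : ℂ) • x k‖ ≤ C := h _ fun k => by
    rw [norm_smul, Complex.norm_real, norm_inv, norm_norm]
    exact inv_mul_le_one
  simpa using mul_le_mul_of_nonneg_right hunit (Finset.prod_nonneg fun k _ => norm_nonneg (x k))

theorem norm_apply_le_of_norm_le_one (a : MForm X m) {x : Fin m → X} (hx : ∀ k, ‖x k‖ ≤ 1) :
    ‖a x‖ ≤ ‖a‖ :=
  a.unit_le_opNorm ((pi_norm_le_iff_of_nonneg zero_le_one).2 hx)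

/-- Of the `2ᵐ` terms in the expansion of `a (u + ζʲ w)`, the one in which `d` of the arguments
come from `w` carries the factor `ζʲᵈ`, and these average to zero unless `d ∈ {0, m}`. -/
theorem sum_apply_add_pow_smul (hm : 0 < m) {ζ : ℂ} (hζ : IsPrimitiveRoot ζ m) (a : MForm X m)
    (u w : Fin m → X) :
    ∑ j ∈ Finset.range m, a (u + ζ ^ j • w) = m * (a u + a w) := by
  have hexpand : ∀ j, a (u + ζ ^ j • w) =
      ∑ s : Finset (Fin m), (ζ ^ s.card) ^ j * a (s.piecewise w u) := fun j => by
    rw [add_comm, a.map_add_univ]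
    refine Finset.sum_congr rfl fun s _ => ?_
    have := a.map_piecewise_smul (fun _ => ζ ^ j) (s.piecewise w u) s
    rw [Finset.prod_const, ← pow_mul, mul_comm, pow_mul, smul_eq_mul] at this
    rw [← this]
    congr 1 with k
    by_cases hk : k ∈ s <;> simp [hk]
  have hgeom : ∀ s : Finset (Fin m), s ≠ ∅ → s ≠ Finset.univ →
      ∑ j ∈ Finset.range m, (ζ ^ s.card) ^ j = 0 := fun s hs hs' => by
    have hlt : s.card < m := by
      simpa using Finset.card_lt_card (Finset.ssubset_univ_iff.2 hs')
    rw [geom_sum_eq (hζ.pow_ne_one_of_pos_of_lt (by simpa using hs) hlt), ← pow_mul, mul_comm,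
      pow_mul, hζ.pow_eq_one, one_pow, sub_self, zero_div]
  simp_rw [hexpand]
  rw [Finset.sum_comm]
  simp_rw [← Finset.sum_mul]
  have hne : (∅ : Finset (Fin m)) ≠ Finset.univ :=
    (@Finset.univ_nonempty _ _ ⟨⟨0, hm⟩⟩).ne_empty.symm
  rw [Finset.sum_eq_add_of_mem _ _ (Finset.mem_univ _) (Finset.mem_univ _) hne
    fun s _ hs => by rw [hgeom s hs.1 hs.2, zero_mul]]
  simp [hζ.pow_eq_one, mul_add]

theorem norm_apply_add_apply_le {P : X →L[ℂ] X} (hP : IsMprojection X P) (hm : 0 < m)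
    (a : MForm X m) {x y : Fin m → X} (hx : ∀ k, ‖x k‖ ≤ 1) (hy : ∀ k, ‖y k‖ ≤ 1) :
    ‖a (fun k => P (x k)) + a (fun k => y k - P (y k))‖ ≤ ‖a‖ := by
  obtain ⟨ζ, hζ⟩ : ∃ ζ : ℂ, IsPrimitiveRoot ζ m :=
    ⟨_, Complex.isPrimitiveRoot_exp m hm.ne'⟩
  have hPP : ∀ x, P (P x) = P x := fun x => congrArg (· x) hP.proj
  have hle : ∀ j k, ‖P (x k) + ζ ^ j • (y k - P (y k))‖ ≤ 1 := fun j k => by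
    have hζj : ‖ζ ^ j‖ = 1 := by rw [norm_pow, hζ.norm'_eq_one hm.ne', one_pow]
    rw [hP.Mnorm]
    simp only [ContinuousLinearMap.smul_def, sub_smul, one_smul, map_add, map_smul, map_sub, hPP,
      sub_self, smul_zero, add_zero, add_sub_cancel_left, norm_smul, hζj, one_mul]
    have hx' := hP.Mnorm (x k)
    have hy' := hP.Mnorm (y k)
    simp only [ContinuousLinearMap.smul_def, sub_smul, one_smul] at hx' hy'
    exact max_le ((le_max_left _ _).trans (hx'.symm.trans_le (hx k)))
      ((le_max_right _ _).trans (hy'.symm.trans_le (hy k)))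
  have hm' : (0 : ℝ) < m := Nat.cast_pos.2 hm
  refine le_of_mul_le_mul_left ?_ hm'
  calc (m : ℝ) * ‖a (fun k => P (x k)) + a (fun k => y k - P (y k))‖
      = ‖∑ j ∈ Finset.range m,
          a ((fun k => P (x k)) + ζ ^ j • fun k => y k - P (y k))‖ := by
        rw [sum_apply_add_pow_smul hm hζ, norm_mul, Complex.norm_natCast]
    _ ≤ ∑ _j ∈ Finset.range m, ‖a‖ :=
        norm_sum_le_of_le _ fun j _ => a.norm_apply_le_of_norm_le_one (hle j)
    _ = m * ‖a‖ := by simp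

theorem norm_apply_add_norm_apply_le {P : X →L[ℂ] X} (hP : IsMprojection X P) (hm : 0 < m)
    (a : MForm X m) {x y : Fin m → X} (hx : ∀ k, ‖x k‖ ≤ 1) (hy : ∀ k, ‖y k‖ ≤ 1) :
    ‖a fun k => P (x k)‖ + ‖a fun k => y k - P (y k)‖ ≤ ‖a‖ := by
  have hrotate : ∀ (T : X →L[ℂ] X) (x : Fin m → X), (∀ k, ‖x k‖ ≤ 1) →
      ∃ x' : Fin m → X, (∀ k, ‖x' k‖ ≤ 1) ∧ a (fun k => T (x' k)) = ‖a fun k => T (x k)‖ := by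
    intro T x hx
    obtain ⟨c, hc, hax⟩ := Complex.exists_norm_eq_mul_self (a fun k => T (x k))
    refine ⟨Function.update x ⟨0, hm⟩ (c • x ⟨0, hm⟩), fun k => ?_, ?_⟩
    · rcases eq_or_ne k ⟨0, hm⟩ with rfl | hk
      · simpa [norm_smul, hc] using hx _
      · simpa [hk] using hx k
    · have h : (fun k => T (Function.update x ⟨0, hm⟩ (c • x ⟨0, hm⟩) k)) =
          Function.update (fun k => T (x k)) ⟨0, hm⟩ (c • T (x ⟨0, hm⟩)) := by
        funext k
        rcases eq_or_ne k ⟨0, hm⟩ with rfl | hk <;> simp [*]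
      rw [h, a.map_update_smul, Function.update_eq_self, hax, smul_eq_mul]
  obtain ⟨x', hx', hax⟩ := hrotate P x hx
  obtain ⟨y', hy', hay⟩ := hrotate (1 - P) y hy
  have hle := norm_apply_add_apply_le hP hm a hx' hy'
  simp only [_root_.sub_apply, one_apply_eq_self] at hay
  rw [hax, hay, ← Complex.ofReal_add, Complex.norm_real] at hle
  exact (le_abs_self _).trans hle

/-- A point `x` at which `a` nearly attains its norm may be replaced by `P N x` for a large `N`,
which leaves no room for a large value of `a` on the range of `1 - P N`. -/
theorem exists_norm_compOn_univ_lt {P : ℕ → X →L[ℂ] X} (hP : ∀ n, IsMprojection X (P n))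
    (hlim : ∀ x, Tendsto (fun n => P n x) atTop (𝓝 x)) (hm : 0 < m) (a : MForm X m) {ε : ℝ}
    (hε : 0 < ε) : ∃ N, ‖a.compOn (1 - P N) Finset.univ‖ < ε := by
  obtain ⟨x, hx, hax⟩ : ∃ x : Fin m → X, (∀ k, ‖x k‖ ≤ 1) ∧ ‖a‖ - ε / 2 < ‖a x‖ := by
    by_contra! h
    linarith [norm_le_of_forall_norm_le_one h]
  have htend : Tendsto (fun n => ‖a fun k => P n (x k)‖) atTop (𝓝 ‖a x‖) :=
    ((a.cont.tendsto _).comp (tendsto_pi_nhds.2 fun k => hlim (x k))).norm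
  obtain ⟨N, hN⟩ := (htend.eventually_const_lt hax).exists
  refine ⟨N, (norm_le_of_forall_norm_le_one fun y hy => ?_).trans_lt (half_lt_self hε)⟩
  simp only [compOn_apply, Finset.mem_univ, if_true]
  have := norm_apply_add_norm_apply_le (hP N) hm a hx hy
  simp only [_root_.sub_apply, one_apply_eq_self]
  linarith

variable {e : ℕ → X} {ℓ : ℕ → StrongDual ℂ X}

/-- The closed span of the monomials in the coordinates. -/
def monomialSpan (ℓ : ℕ → StrongDual ℂ X) (m : ℕ) : Submodule ℂ (MForm X m) :=
  (Submodule.span ℂ (range (monomial ℓ))).topologicalClosure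

theorem monomial_mem_monomialSpan (ℓ : ℕ → StrongDual ℂ X) (i : Fin m → ℕ) :
    monomial ℓ i ∈ monomialSpan ℓ m :=
  Submodule.le_topologicalClosure _ (Submodule.subset_span (mem_range_self i))

theorem uncurryMid_smulRight_mem_monomialSpan {c : MForm X m} (hc : c ∈ monomialSpan ℓ m) (i : ℕ)
    (p : Fin (m + 1)) :
    (((ℓ i).smulRight c).uncurryMid p : MForm X (m + 1)) ∈ monomialSpan ℓ (m + 1) := by
  let T : MForm X m →L[ℂ] MForm X (m + 1) :=
    ((ContinuousMultilinearMap.curryMidEquiv ℂ (fun _ : Fin (m + 1) => X)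
      ℂ p).symm.toContinuousLinearEquiv : _ →L[ℂ] _).comp
        (ContinuousLinearMap.smulRightL ℂ X (MForm X m) (ℓ i))
  have hspan : Submodule.span ℂ (range (monomial ℓ)) ≤
      (monomialSpan ℓ (m + 1)).comap (T : MForm X m →ₗ[ℂ] MForm X (m + 1)) := by
    refine Submodule.span_le.2 ?_
    rintro _ ⟨j, rfl⟩
    have hT : T (monomial ℓ j) = monomial ℓ (p.insertNth (α := fun _ => ℕ) i j) := by
      ext x
      rw [monomial_apply, Fin.prod_univ_succAbove _ p]
      simp [T, monomial_apply, Fin.removeNth]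
    change T (monomial ℓ j) ∈ monomialSpan ℓ (m + 1)
    rw [hT]
    exact monomial_mem_monomialSpan ℓ _
  exact Submodule.topologicalClosure_minimal _ hspan
    ((Submodule.isClosed_topologicalClosure _).preimage T.continuous) hc

theorem compOn_basisProj_mem_monomialSpan (h : ∀ c : MForm X m, c ∈ monomialSpan ℓ m)
    (a : MForm X (m + 1)) (p : Fin (m + 1)) (n : ℕ) :
    a.compOn (basisProj e ℓ n) {p} ∈ monomialSpan ℓ (m + 1) := by
  have hsum : a.compOn (basisProj e ℓ n) {p} =
      ∑ i ∈ Finset.range n, ((ℓ i).smulRight (a.curryMid p (e i))).uncurryMid p := by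
    ext x
    rw [compOn_singleton_apply, ← Fin.insertNth_removeNth,
      ← ContinuousMultilinearMap.curryMid_apply, basisProj_apply, map_sum, _root_.sum_apply,
      _root_.sum_apply]
    simp
  rw [hsum]
  exact sum_mem fun i _ => uncurryMid_smulRight_mem_monomialSpan (h _) i p

theorem sub_compOn_mem_monomialSpan (h : ∀ c : MForm X m, c ∈ monomialSpan ℓ m)
    (a : MForm X (m + 1)) (n : ℕ) (s : Finset (Fin (m + 1))) :
    a - a.compOn (1 - basisProj e ℓ n) s ∈ monomialSpan ℓ (m + 1) := by
  induction s using Finset.induction_on with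
  | empty =>
    have : a.compOn (1 - basisProj e ℓ n) ∅ = a := by
      ext x
      simp [compOn_apply]
    rw [this, sub_self]
    exact zero_mem _
  | insert p s hp ih =>
    have hp' := compOn_basisProj_mem_monomialSpan (e := e) h (a.compOn (1 - basisProj e ℓ n) s) p n
    rw [compOn_insert _ _ hp, compOn_one_sub_singleton, ← sub_add]
    exact add_mem ih hp'

theorem mem_monomialSpan (H : IsCZeroBasis e ℓ) : ∀ {m : ℕ} (a : MForm X m), a ∈ monomialSpan ℓ m
  | 0, a => by
    have : a = a 0 • monomial ℓ ![] := by
      ext x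
      rw [_root_.smul_apply, monomial_apply, Subsingleton.elim x 0]
      simp
    rw [this]
    exact Submodule.smul_mem _ _ (monomial_mem_monomialSpan ℓ _)
  | m + 1, a => by
    refine (Submodule.isClosed_topologicalClosure _).closure_subset_iff.2 subset_rfl <|
      Metric.mem_closure_iff.2 fun ε hε => ?_
    obtain ⟨N, hN⟩ := exists_norm_compOn_univ_lt H.isMprojection_basisProj H.tendsto_basisProj
      m.succ_pos a hε
    exact ⟨_, sub_compOn_mem_monomialSpan (fun c => mem_monomialSpan H c) a N Finset.univ,
      by simpa [dist_eq_norm] using hN⟩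

end MForm

end MultilinearForms

section Taylor

theorem exists_gt_mul_lt_one {s c : ℝ} (h : s * c < 1) : ∃ s' > s, s' * c < 1 := by
  have hcont : Tendsto (fun t : ℝ => t * c) (𝓝[>] s) (𝓝 (s * c)) :=
    ((continuous_mul_const c).tendsto s).mono_left nhdsWithin_le_nhds
  obtain ⟨s', hlt, hgt⟩ := ((hcont.eventually_lt_const h).and self_mem_nhdsWithin).exists
  exact ⟨s', hgt, hlt⟩

variable {X : Type*} [NormedAddCommGroup X] [NormedSpace ℂ X] {F : X → ℂ}

/-- The multilinear form of the `m`-th Taylor polynomial of `F` at the origin. -/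
def taylorForm (F : X → ℂ) (m : ℕ) : MForm X m :=
  (Nat.factorial m : ℂ)⁻¹ • iteratedFDeriv ℂ m F 0

theorem iteratedDeriv_comp_smul (hF : AnalyticOnNhd ℂ F (ball 0 1)) (x : X) (m : ℕ) :
    iteratedDeriv m (fun t : ℂ => F (t • x)) 0 = iteratedFDeriv ℂ m F 0 fun _ => x := by
  let g : ℂ →L[ℂ] X := ContinuousLinearMap.toSpanSingleton ℂ x
  have hg : IsOpen (g ⁻¹' ball 0 1) := isOpen_ball.preimage g.continuous
  have h0 : g 0 ∈ ball (0 : X) 1 := by simp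
  have h := g.iteratedFDerivWithin_comp_right (n := ⊤) (s := ball (0 : X) 1) (f := F)
    (hF.contDiffOn isOpen_ball.uniqueDiffOn) isOpen_ball.uniqueDiffOn hg.uniqueDiffOn h0 (i := m)
    (by exact_mod_cast le_top)
  rw [iteratedFDerivWithin_of_isOpen m hg (by simp),
    iteratedFDerivWithin_of_isOpen m isOpen_ball h0, map_zero] at h
  rw [iteratedDeriv_eq_iteratedFDeriv]
  change iteratedFDeriv ℂ m (F ∘ g) 0 (fun _ => 1) = _
  rw [h]
  simp [g]

theorem differentiableOn_comp_smul (hF : AnalyticOnNhd ℂ F (ball 0 1)) {x : X} {s : ℝ}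
    (hs : s * ‖x‖ ≤ 1) : DifferentiableOn ℂ (fun t : ℂ => F (t • x)) (ball 0 s) := by
  refine hF.differentiableOn.comp (t := ball 0 1) (by fun_prop) fun t ht => ?_
  rw [mem_ball_zero_iff] at ht ⊢
  rw [norm_smul]
  rcases (norm_nonneg x).eq_or_lt with h | h
  · rw [← h, mul_zero]
    exact one_pos
  · exact (mul_lt_mul_of_pos_right ht h).trans_le hs

theorem norm_taylorForm_le (hF : AnalyticOnNhd ℂ F (ball 0 1)) {C : ℝ}
    (hC : ∀ y ∈ ball (0 : X) 1, ‖F y‖ ≤ C) {x : X} {s : ℝ} (hs : 0 < s) (hsx : s * ‖x‖ < 1)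
    (m : ℕ) : ‖taylorForm F m fun _ => x‖ ≤ C / s ^ m := by
  obtain ⟨s', hs', hs'x⟩ := exists_gt_mul_lt_one hsx
  have hcauchy := Complex.norm_iteratedDeriv_le_of_forall_mem_sphere_norm_le (C := C) m hs
    ((differentiableOn_comp_smul hF hs'x.le).diffContOnCl_ball (closedBall_subset_ball hs'))
    fun t ht => hC _ <| by
      rw [mem_ball_zero_iff, norm_smul, mem_sphere_zero_iff_norm.1 ht]
      exact hsx
  rw [iteratedDeriv_comp_smul hF, mul_div_assoc] at hcauchy
  rwa [taylorForm, _root_.smul_apply, norm_smul, norm_inv, Complex.norm_natCast,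
    inv_mul_le_iff₀ (Nat.cast_pos.2 m.factorial_pos)]

theorem hasSum_taylorForm (hF : AnalyticOnNhd ℂ F (ball 0 1)) {x : X} (hx : ‖x‖ < 1) :
    HasSum (fun m => taylorForm F m fun _ => x) (F x) := by
  obtain ⟨s, hs, hsx⟩ := exists_gt_mul_lt_one ((one_mul ‖x‖).trans_lt hx)
  have h := Complex.hasSum_taylorSeries_on_ball (differentiableOn_comp_smul hF hsx.le)
    (z := 1) (by simpa using hs)
  simp only [sub_zero, one_pow, one_smul, iteratedDeriv_comp_smul hF] at h
  exact h

end Taylor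

section AuElements

variable {X : Type*} [NormedAddCommGroup X] [NormedSpace ℂ X]

theorem evalChar_apply (x : ball (0 : X) 1) (f : Au X) : evalChar X x f = f.1 x := rfl

namespace Au

/-- The element of `𝒜_u(B_X)` given by a function on `X`. -/
def ofFun (F : X → ℂ) (hF : AnalyticOnNhd ℂ F (ball 0 1))
    (hu : UniformContinuousOn F (ball 0 1)) (C : ℝ) (hC : ∀ x ∈ ball (0 : X) 1, ‖F x‖ ≤ C) :
    Au X :=
  ⟨BoundedContinuousFunction.ofNormedAddCommGroup (fun x : ball (0 : X) 1 => F x)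
    (uniformContinuousOn_iff_restrict.1 hu).continuous C fun x => hC x x.2,
    uniformContinuousOn_iff_restrict.1 hu, hF.congr isOpen_ball fun x hx => by
      rw [zeroExt_eq _ hx]; rfl⟩

theorem norm_apply_le (f : Au X) (x : ball (0 : X) 1) : ‖f.1 x‖ ≤ ‖f‖ :=
  f.1.norm_coe_le_norm x

theorem norm_le_of_forall {f : Au X} {C : ℝ} (h : ∀ x, ‖f.1 x‖ ≤ C) : ‖f‖ ≤ C :=
  (BoundedContinuousFunction.norm_le ((norm_nonneg _).trans (h ⟨0, by simp⟩))).2 h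

protected theorem ext {f g : Au X} (h : ∀ x, f.1 x = g.1 x) : f = g :=
  Subtype.ext (BoundedContinuousFunction.ext h)

instance : NormOneClass (Au X) where
  norm_one := le_antisymm (norm_le_of_forall fun _ => norm_one.le)
    (norm_one.symm.trans_le (norm_apply_le 1 ⟨0, by simp⟩))

theorem norm_zeroExt_le (f : Au X) (x : X) (hx : x ∈ ball (0 : X) 1) :
    ‖zeroExt f.1 x‖ ≤ ‖f‖ := by
  rw [zeroExt_eq _ hx]
  exact norm_apply_le f _

theorem analyticOnNhd (f : Au X) : AnalyticOnNhd ℂ (zeroExt f.1) (ball 0 1) := f.2.2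

theorem uniformContinuousOn (f : Au X) : UniformContinuousOn (zeroExt f.1) (ball 0 1) := by
  rw [uniformContinuousOn_iff_restrict]
  convert! f.2.1 using 1
  ext x
  exact zeroExt_eq _ x.2

/-- A continuous linear functional as an element of `𝒜_u(B_X)`. -/
def ofDual (φ : StrongDual ℂ X) : Au X :=
  ofFun φ (φ.analyticOnNhd _) φ.uniformContinuous.uniformContinuousOn ‖φ‖ fun x hx =>
    (φ.le_opNorm x).trans (mul_le_of_le_one_right (norm_nonneg _) (mem_ball_zero_iff.1 hx).le)

theorem uniformContinuousOn_diag {m : ℕ} (a : MForm X m) :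
    UniformContinuousOn (fun x => a fun _ => x) (ball (0 : X) 1) := by
  refine (LipschitzOnWith.of_dist_le_mul (K := ‖a‖₊ * m) fun x hx y hy => ?_).uniformContinuousOn
  rw [dist_eq_norm, dist_eq_norm]
  have hone : ∀ x ∈ ball (0 : X) 1, ‖fun _ : Fin m => x‖ ≤ 1 := fun x hx =>
    (pi_norm_const_le x).trans (mem_ball_zero_iff.1 hx).le
  calc ‖(a fun _ => x) - a fun _ => y‖
      ≤ ‖a‖ * Fintype.card (Fin m) * max ‖fun _ : Fin m => x‖ ‖fun _ : Fin m => y‖ ^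
          (Fintype.card (Fin m) - 1) * ‖(fun _ : Fin m => x) - fun _ => y‖ :=
        a.norm_image_sub_le _ _
    _ ≤ ‖a‖ * m * 1 * ‖x - y‖ := by
        rw [Fintype.card_fin]
        gcongr
        · exact pow_le_one₀ (le_max_of_le_left (norm_nonneg _)) (max_le (hone x hx) (hone y hy))
        · exact pi_norm_const_le (x - y)
    _ = (‖a‖₊ * m : NNReal) * ‖x - y‖ := by simp

/-- The homogeneous polynomial `x ↦ a(x, …, x)` as an element of `𝒜_u(B_X)`. -/
def ofForm (m : ℕ) : MForm X m →L[ℂ] Au X :=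
  LinearMap.mkContinuous
    { toFun := fun a => ofFun (fun x => a fun _ => x)
        (fun x _ => (a.analyticAt (x := fun _ => x)).comp
          ((ContinuousLinearMap.pi fun _ : Fin m => .id ℂ X).analyticAt x))
        (uniformContinuousOn_diag a) ‖a‖
        fun x hx => a.norm_apply_le_of_norm_le_one fun _ => (mem_ball_zero_iff.1 hx).le
      map_add' := fun _ _ => rfl
      map_smul' := fun _ _ => rfl } 1
    fun a => by
      rw [one_mul]
      exact norm_le_of_forall fun x =>
        a.norm_apply_le_of_norm_le_one fun _ => (mem_ball_zero_iff.1 x.2).le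

theorem ofForm_apply {m : ℕ} (a : MForm X m) (x : ball (0 : X) 1) :
    (ofForm m a).1 x = a fun _ => (x : X) := rfl

variable {Y : Type*} [NormedAddCommGroup Y] [NormedSpace ℂ Y] (R : X →L[ℂ] Y)
  (hR : ∀ x, ‖R x‖ ≤ ‖x‖)

include hR in
theorem mapsTo_unitBall : MapsTo R (ball 0 1) (ball 0 1) := fun x hx =>
  mem_ball_zero_iff.2 ((hR x).trans_lt (mem_ball_zero_iff.1 hx))

/-- Composition with a contraction. -/
def compCLM (g : Au Y) : Au X :=
  ofFun (fun x => zeroExt g.1 (R x))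
    ((analyticOnNhd g).comp (R.analyticOnNhd _) (mapsTo_unitBall R hR))
    ((uniformContinuousOn g).comp R.uniformContinuous.uniformContinuousOn
      (mapsTo_unitBall R hR)) ‖g‖
    fun _ hx => norm_zeroExt_le g _ (mapsTo_unitBall R hR hx)

theorem compCLM_apply (g : Au Y) (x : ball (0 : X) 1) :
    (compCLM R hR g).1 x = g.1 ⟨R x, mapsTo_unitBall R hR x.2⟩ :=
  zeroExt_eq _ _

theorem norm_compCLM_le (g : Au Y) : ‖compCLM R hR g‖ ≤ ‖g‖ :=
  norm_le_of_forall fun x => norm_zeroExt_le g _ (mapsTo_unitBall R hR x.2)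

end Au

end AuElements

section Density

variable {X : Type*} [NormedAddCommGroup X] [NormedSpace ℂ X]

/-- The algebra of polynomials in the coordinates. -/
def coordPoly (ℓ : ℕ → StrongDual ℂ X) : Subalgebra ℂ (Au X) :=
  Algebra.adjoin ℂ (range fun n => Au.ofDual (ℓ n))

variable {e : ℕ → X} {ℓ : ℕ → StrongDual ℂ X}

theorem ofForm_monomial {m : ℕ} (i : Fin m → ℕ) :
    Au.ofForm m (MForm.monomial ℓ i) = ∏ k, Au.ofDual (ℓ (i k)) :=
  Au.ext fun x => by
    rw [Au.ofForm_apply, MForm.monomial_apply, ← evalChar_apply, map_prod]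
    rfl

theorem ofForm_mem_topologicalClosure_coordPoly (H : IsCZeroBasis e ℓ) {m : ℕ} (a : MForm X m) :
    Au.ofForm m a ∈ (coordPoly ℓ).topologicalClosure := by
  have hspan : Submodule.span ℂ (range (MForm.monomial ℓ)) ≤
      (Subalgebra.toSubmodule (coordPoly ℓ).topologicalClosure).comap
        (Au.ofForm (X := X) m : MForm X m →ₗ[ℂ] Au X) := by
    refine Submodule.span_le.2 ?_
    rintro _ ⟨i, rfl⟩
    refine (coordPoly ℓ).le_topologicalClosure ?_
    change Au.ofForm m _ ∈ coordPoly ℓ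
    rw [ofForm_monomial]
    exact prod_mem fun k _ => Algebra.subset_adjoin ⟨i k, rfl⟩
  exact Submodule.topologicalClosure_minimal _ hspan
    ((coordPoly ℓ).isClosed_topologicalClosure.preimage (Au.ofForm m).continuous)
    (MForm.mem_monomialSpan H a)

theorem norm_smul_id_apply_le {r : ℝ} (h0 : 0 ≤ r) (h1 : r ≤ 1) (x : X) :
    ‖((r : ℂ) • ContinuousLinearMap.id ℂ X) x‖ ≤ ‖x‖ := by
  rw [_root_.smul_apply, ContinuousLinearMap.id_apply, norm_smul, Complex.norm_real,
    Real.norm_of_nonneg h0]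
  exact mul_le_of_le_one_left (norm_nonneg x) h1

/-- The function `x ↦ f (r x)`. -/
def Au.dilate (f : Au X) (r : unitInterval) : Au X :=
  Au.compCLM ((r.1 : ℂ) • .id ℂ X) (norm_smul_id_apply_le r.2.1 r.2.2) f

theorem norm_dilate_sub_sum_taylorForm_le (f : Au X) {r : unitInterval} (hr0 : 0 < r.1)
    (hr1 : r.1 < 1) (M : ℕ) :
    ‖∑ m ∈ Finset.range M, (r.1 : ℂ) ^ m • Au.ofForm m (taylorForm (zeroExt f.1) m) -
        Au.dilate f r‖ ≤ ‖f‖ * r.1 ^ M / (1 - r.1) := by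
  refine Au.norm_le_of_forall fun x => ?_
  have hnorm : ‖(r.1 : ℂ) • (x : X)‖ = r.1 * ‖(x : X)‖ := by
    rw [norm_smul, Complex.norm_real, Real.norm_of_nonneg hr0.le]
  have hx : ‖(x : X)‖ < 1 := mem_ball_zero_iff.1 x.2
  have hterm : ∀ m, evalChar X x ((r.1 : ℂ) ^ m • Au.ofForm m (taylorForm (zeroExt f.1) m)) =
      taylorForm (zeroExt f.1) m fun _ => (r.1 : ℂ) • (x : X) := fun m => by
    rw [map_smul, evalChar_apply, Au.ofForm_apply, ContinuousMultilinearMap.map_smul_univ]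
    simp
  rw [← evalChar_apply, map_sub, map_sum, Finset.sum_congr rfl fun m _ => hterm m]
  refine norm_sub_le_of_geometric_bound_of_hasSum hr1 (fun m => ?_)
    (hasSum_taylorForm (Au.analyticOnNhd f) (hnorm.trans_lt
      (mul_lt_one_of_nonneg_of_lt_one_left hr0.le hr1 hx.le))) M
  have := norm_taylorForm_le (Au.analyticOnNhd f) (Au.norm_zeroExt_le f) (x := (r.1 : ℂ) • (x : X))
    (s := r.1⁻¹) (inv_pos.2 hr0) (by rwa [hnorm, inv_mul_cancel_left₀ hr0.ne']) m
  rwa [inv_pow, div_inv_eq_mul] at this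

theorem dilate_mem_topologicalClosure_coordPoly (H : IsCZeroBasis e ℓ) (f : Au X)
    {r : unitInterval} (hr0 : 0 < r.1) (hr1 : r.1 < 1) :
    Au.dilate f r ∈ (coordPoly ℓ).topologicalClosure := by
  have hpartial : ∀ M, ∑ m ∈ Finset.range M,
      (r.1 : ℂ) ^ m • Au.ofForm m (taylorForm (zeroExt f.1) m) ∈
        (coordPoly ℓ).topologicalClosure := fun M => sum_mem fun m _ =>
    Subalgebra.smul_mem _ (ofForm_mem_topologicalClosure_coordPoly H _) _
  have herror : Tendsto (fun M : ℕ => ‖f‖ * r.1 ^ M / (1 - r.1)) atTop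
      (𝓝 (‖f‖ * 0 / (1 - r.1))) :=
    ((tendsto_pow_atTop_nhds_zero_of_lt_one hr0.le hr1).const_mul ‖f‖).div_const (1 - r.1)
  rw [mul_zero, zero_div] at herror
  exact (coordPoly ℓ).isClosed_topologicalClosure.mem_of_tendsto
    (tendsto_iff_norm_sub_tendsto_zero.2 <| squeeze_zero (fun _ => norm_nonneg _)
      (norm_dilate_sub_sum_taylorForm_le f hr0 hr1) herror)
    (Eventually.of_forall hpartial)

theorem exists_norm_sub_dilate_le (f : Au X) {ε : ℝ} (hε : 0 < ε) :
    ∃ r : unitInterval, 0 < r.1 ∧ r.1 < 1 ∧ ‖f - Au.dilate f r‖ ≤ ε := by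
  obtain ⟨d, hd, hfd⟩ := Metric.uniformContinuous_iff.1 f.2.1 ε hε
  obtain ⟨r, hrd, hr1⟩ := exists_between (max_lt (sub_lt_self 1 hd) one_pos)
  obtain ⟨hrd, hr0⟩ := max_lt_iff.1 hrd
  refine ⟨⟨r, hr0.le, hr1.le⟩, hr0, hr1, Au.norm_le_of_forall fun x => ?_⟩
  rw [← evalChar_apply, map_sub, evalChar_apply, evalChar_apply, Au.dilate, Au.compCLM_apply,
    ← dist_eq_norm]
  refine (hfd ?_).le
  have hsub : (x : X) - (r : ℂ) • (x : X) = ((1 - r : ℝ) : ℂ) • (x : X) := by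
    rw [Complex.ofReal_sub, Complex.ofReal_one, sub_smul, one_smul]
  rw [Subtype.dist_eq, dist_eq_norm]
  change ‖(x : X) - (r : ℂ) • (x : X)‖ < d
  rw [hsub, norm_smul, Complex.norm_real, Real.norm_of_nonneg (sub_pos.2 hr1).le]
  exact (mul_le_of_le_one_right (sub_pos.2 hr1).le (mem_ball_zero_iff.1 x.2).le).trans_lt
    (by linarith)

theorem dense_coordPoly (H : IsCZeroBasis e ℓ) : Dense (coordPoly ℓ : Set (Au X)) := by
  refine fun f => closure_closure (s := (coordPoly ℓ : Set (Au X))) ▸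
    Metric.mem_closure_iff.2 fun ε hε => ?_
  obtain ⟨r, hr0, hr1, hr⟩ := exists_norm_sub_dilate_le f (half_pos hε)
  exact ⟨_, dilate_mem_topologicalClosure_coordPoly H f hr0 hr1,
    (dist_eq_norm f _).trans_lt (hr.trans_lt (half_lt_self hε))⟩

end Density

section CharacterSpace

variable {A : Type*} [NormedRing A] [NormedAlgebra ℂ A]

theorem character_norm_apply_le (φ : characterSpace ℂ A) (f : A) : ‖φ f‖ ≤ ‖f‖ := by
  by_contra! h
  have hφ : φ f ≠ 0 := norm_pos_iff.1 ((norm_nonneg f).trans_lt h)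
  have hg : ‖(φ f)⁻¹ • f‖ < 1 := by
    rwa [norm_smul, norm_inv, inv_mul_lt_one₀ (norm_pos_iff.2 hφ)]
  have hone : ∀ n : ℕ, φ (((φ f)⁻¹ • f) ^ n) = 1 := fun n => by
    rw [map_pow, map_smul, smul_eq_mul, inv_mul_cancel₀ hφ, one_pow]
  have hlim : Tendsto (fun n : ℕ => φ (((φ f)⁻¹ • f) ^ n)) atTop (𝓝 (φ 0)) :=
    ((map_continuous φ).tendsto 0).comp (tendsto_pow_atTop_nhds_zero_of_norm_lt_one hg)
  simp only [hone, map_zero, tendsto_const_nhds_iff, one_ne_zero] at hlim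

/-- Mathlib derives the compactness of the character space from the completeness of the algebra;
by `character_norm_apply_le` only the continuity of the characters is needed. -/
theorem compactSpace_characterSpace : CompactSpace (characterSpace ℂ A) := by
  rw [← isCompact_iff_compactSpace]
  refine (WeakDual.isCompact_closedBall (𝕜 := ℂ) (E := A) 0 1).of_isClosed_subset
    CharacterSpace.isClosed fun φ hφ => ?_
  rw [mem_preimage, mem_closedBall_zero_iff]
  exact ContinuousLinearMap.opNorm_le_bound _ zero_le_one fun f =>
    (character_norm_apply_le ⟨φ, hφ⟩ f).trans (one_mul ‖f‖).ge

end CharacterSpace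

section Coordinates

variable {X : Type*} [NormedAddCommGroup X] [NormedSpace ℂ X] {e : ℕ → X} {ℓ : ℕ → StrongDual ℂ X}

/-- The coordinates of a character, that is, its values on the coordinate functionals. They identify
the spectrum with the countable power of the closed disc. -/
def charCoord (ℓ : ℕ → StrongDual ℂ X) (φ : characterSpace ℂ (Au X)) (k : ℕ) : ℂ :=
  φ (Au.ofDual (ℓ k))

theorem continuous_charCoord (ℓ : ℕ → StrongDual ℂ X) : Continuous (charCoord ℓ) :=
  continuous_pi fun k => (WeakDual.eval_continuous (Au.ofDual (ℓ k))).comp continuous_subtype_val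

namespace IsCZeroBasis

theorem injective_charCoord (H : IsCZeroBasis e ℓ) : Function.Injective (charCoord ℓ) := by
  intro φ ψ h
  have hpoly : coordPoly ℓ ≤
      AlgHom.equalizer (CharacterSpace.toAlgHom φ) (CharacterSpace.toAlgHom ψ) :=
    Algebra.adjoin_le (by rintro _ ⟨n, rfl⟩; exact congrFun h n)
  exact DFunLike.coe_injective <| (map_continuous φ).ext_on (dense_coordPoly H)
    (map_continuous ψ) hpoly

theorem isClosedEmbedding_charCoord (H : IsCZeroBasis e ℓ) : IsClosedEmbedding (charCoord ℓ) :=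
  have := compactSpace_characterSpace (A := Au X)
  (continuous_charCoord ℓ).isClosedEmbedding H.injective_charCoord

theorem tendsto_apply_of_tendsto_charCoord (H : IsCZeroBasis e ℓ) {ι : Type*} {l : Filter ι}
    {φ : ι → characterSpace ℂ (Au X)} {ψ : characterSpace ℂ (Au X)}
    (h : ∀ k, Tendsto (fun i => charCoord ℓ (φ i) k) l (𝓝 (charCoord ℓ ψ k))) (f : Au X) :
    Tendsto (fun i => φ i f) l (𝓝 (ψ f)) :=
  (((WeakDual.eval_continuous f).comp continuous_subtype_val).tendsto ψ).comp
    (H.isClosedEmbedding_charCoord.tendsto_nhds_iff.2 (tendsto_pi_nhds.2 h))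

theorem norm_charCoord_le_one (H : IsCZeroBasis e ℓ) (φ : characterSpace ℂ (Au X)) (k : ℕ) :
    ‖charCoord ℓ φ k‖ ≤ 1 :=
  (character_norm_apply_le φ _).trans <| Au.norm_le_of_forall fun x =>
    (H.norm_coord_le k x).trans (mem_ball_zero_iff.1 x.2).le

/-- Points of the open ball whose coordinates approach those of `z`: the truncations of `z` are
scaled by a factor that tends to one, so that they lie in the open ball. -/
def approxPt (H : IsCZeroBasis e ℓ) {z : ℕ → ℂ} (hz : ∀ k, ‖z k‖ ≤ 1) (n : ℕ) : ball (0 : X) 1 :=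
  ⟨((n / (n + 1) : ℝ) : ℂ) • seqTrunc e n z, by
    have hpos : (0 : ℝ) < n + 1 := n.cast_add_one_pos
    rw [mem_ball_zero_iff, norm_smul, Complex.norm_real, Real.norm_of_nonneg (by positivity)]
    exact (mul_le_of_le_one_right (by positivity) (H.norm_seqTrunc_le zero_le_one hz n)).trans_lt
      ((div_lt_one hpos).2 (lt_add_one _))⟩

theorem tendsto_coord_approxPt (H : IsCZeroBasis e ℓ) {z : ℕ → ℂ} (hz : ∀ k, ‖z k‖ ≤ 1) (k : ℕ) :
    Tendsto (fun n => ℓ k (H.approxPt hz n)) atTop (𝓝 (z k)) := by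
  have hscale : Tendsto (fun n : ℕ => ((n / (n + 1) : ℝ) : ℂ)) atTop (𝓝 1) :=
    (Complex.continuous_ofReal.tendsto 1).comp (tendsto_natCast_div_add_atTop 1)
  simpa only [approxPt, map_smul, one_smul] using hscale.smul (H.tendsto_coord_seqTrunc z k)

theorem norm_approxPt_sub_le (H : IsCZeroBasis e ℓ) {z w : ℕ → ℂ} (hz : ∀ k, ‖z k‖ ≤ 1)
    (hw : ∀ k, ‖w k‖ ≤ 1) {C : ℝ} (hC : 0 ≤ C) (h : ∀ k, ‖z k - w k‖ ≤ C) (n : ℕ) :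
    ‖(H.approxPt hz n : X) - H.approxPt hw n‖ ≤ C := by
  have hsub : seqTrunc e n z - seqTrunc e n w = seqTrunc e n fun k => z k - w k := by
    simp only [seqTrunc, ← Finset.sum_sub_distrib, sub_smul]
  simp only [approxPt, ← smul_sub, hsub]
  rw [norm_smul, Complex.norm_real, Real.norm_of_nonneg (by positivity)]
  exact (mul_le_of_le_one_left (norm_nonneg _) (div_le_one_of_le₀ (lt_add_one _).le
    (by positivity))).trans (H.norm_seqTrunc_le hC h n)

theorem range_charCoord (H : IsCZeroBasis e ℓ) :
    range (charCoord ℓ) = {z | ∀ k, ‖z k‖ ≤ 1} := by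
  refine subset_antisymm (range_subset_iff.2 fun φ => H.norm_charCoord_le_one φ) fun z hz => ?_
  exact H.isClosedEmbedding_charCoord.isClosed_range.mem_of_tendsto
    (tendsto_pi_nhds.2 (H.tendsto_coord_approxPt hz))
    (Eventually.of_forall fun n => ⟨evalChar X (H.approxPt hz n), rfl⟩)

theorem tendsto_approxPt (H : IsCZeroBasis e ℓ) (φ : characterSpace ℂ (Au X)) (f : Au X) :
    Tendsto (fun n => f.1 (H.approxPt (H.norm_charCoord_le_one φ) n)) atTop (𝓝 (φ f)) :=
  H.tendsto_apply_of_tendsto_charCoord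
    (φ := fun n => evalChar X (H.approxPt (H.norm_charCoord_le_one φ) n))
    (H.tendsto_coord_approxPt _) f

theorem exists_forall_norm_sub_le (H : IsCZeroBasis e ℓ) (f : Au X) {ε : ℝ} (hε : 0 < ε) :
    ∃ d > 0, ∀ φ ψ : characterSpace ℂ (Au X),
      (∀ k, ‖charCoord ℓ φ k - charCoord ℓ ψ k‖ < d) → ‖φ f - ψ f‖ ≤ ε := by
  obtain ⟨d, hd, hfd⟩ := Metric.uniformContinuous_iff.1 f.2.1 ε hε
  refine ⟨d / 2, half_pos hd, fun φ ψ h => ?_⟩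
  refine le_of_tendsto ((H.tendsto_approxPt φ f).sub (H.tendsto_approxPt ψ f)).norm
    (Eventually.of_forall fun n => ?_)
  rw [← dist_eq_norm]
  refine (hfd ((dist_eq_norm _ _).trans_lt ?_)).le
  exact (H.norm_approxPt_sub_le _ _ (half_pos hd).le (fun k => (h k).le) n).trans_lt
    (half_lt_self hd)

end IsCZeroBasis

end Coordinates

section AronBerner

variable {X : Type*} [NormedAddCommGroup X] [NormedSpace ℂ X] {e : ℕ → X} {ℓ : ℕ → StrongDual ℂ X}

theorem aronBerner_monomial (ζ : StrongDual ℂ (StrongDual ℂ X)) :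
    ∀ {m : ℕ} (i : Fin m → ℕ), aronBerner ζ m (MForm.monomial ℓ i) = ∏ k, ζ (ℓ (i k))
  | 0, i => by
    change MForm.monomial ℓ i 0 = _
    simp [MForm.monomial_apply]
  | m + 1, i => by
    have hcurry : (aronBerner ζ m).comp (MForm.monomial ℓ i).curryLeft =
        (∏ k : Fin m, ζ (ℓ (i k.succ))) • ℓ (i 0) := by
      ext x
      have : (MForm.monomial ℓ i).curryLeft x =
          ℓ (i 0) x • MForm.monomial ℓ fun k : Fin m => i k.succ := by
        ext y
        simp [MForm.monomial_apply, Fin.prod_univ_succ]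
      rw [ContinuousLinearMap.comp_apply, this, map_smul, aronBerner_monomial ζ]
      simp [mul_comm]
    rw [aronBerner_succ, hcurry, map_smul, smul_eq_mul, Fin.prod_univ_succ, mul_comm]

namespace IsCZeroBasis

theorem tendsto_aronBerner (H : IsCZeroBasis e ℓ) {ι : Type*} {l : Filter ι} {x : ι → X}
    (hx : ∀ i, ‖x i‖ ≤ 1) {ζ : StrongDual ℂ (StrongDual ℂ X)}
    (h : ∀ k, Tendsto (fun i => ℓ k (x i)) l (𝓝 (ζ (ℓ k)))) {m : ℕ} (a : MForm X m) :
    Tendsto (fun i => a fun _ => x i) l (𝓝 (aronBerner ζ m a)) := by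
  let L : Submodule ℂ (MForm X m) :=
    { carrier := {a | Tendsto (fun i => a fun _ => x i) l (𝓝 (aronBerner ζ m a))}
      add_mem' := fun ha hb => by
        simpa only [mem_ofPred_eq, map_add, _root_.add_apply] using Tendsto.add ha hb
      zero_mem' := by simpa using tendsto_const_nhds
      smul_mem' := fun c a ha => by
        simpa only [mem_ofPred_eq, map_smul, _root_.smul_apply] using Tendsto.const_smul ha c }
  have hL : IsClosed (L : Set (MForm X m)) := by
    refine Equicontinuous.isClosed_setOfPred_tendsto
      (UniformEquicontinuous.equicontinuous ?_) (aronBerner ζ m).continuous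
    refine Metric.uniformEquicontinuous_of_continuity_modulus id tendsto_id _ fun a b i => ?_
    rw [dist_eq_norm, dist_eq_norm, ← _root_.sub_apply]
    exact (a - b).norm_apply_le_of_norm_le_one fun _ => hx i
  refine Submodule.topologicalClosure_minimal _ (Submodule.span_le.2 ?_) hL
    (MForm.mem_monomialSpan H a)
  rintro _ ⟨i, rfl⟩
  simp only [L, SetLike.mem_coe, Submodule.mem_mk, AddSubmonoid.mem_mk, AddSubsemigroup.mem_mk,
    mem_ofPred_eq, MForm.monomial_apply, aronBerner_monomial]
  exact tendsto_finsetProd _ fun k _ => h (i k)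

theorem hasSum_taylorExt (H : IsCZeroBasis e ℓ) {φ : characterSpace ℂ (Au X)}
    {ζ : StrongDual ℂ (StrongDual ℂ X)} (hζ : ∀ k, ζ (ℓ k) = charCoord ℓ φ k) {ρ : ℝ} (hρ : ρ < 1)
    (h : ∀ k, ‖charCoord ℓ φ k‖ ≤ ρ) (f : Au X) : HasSum (taylorExt f.1 ζ) (φ f) := by
  have hρ0 : 0 ≤ ρ := (norm_nonneg _).trans (h 0)
  let x : ℕ → X := fun n => seqTrunc e n (charCoord ℓ φ)
  have hx : ∀ n, ‖x n‖ ≤ ρ := H.norm_seqTrunc_le hρ0 h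
  have hx1 : ∀ n, ‖x n‖ < 1 := fun n => (hx n).trans_lt hρ
  have hcoord : ∀ k, Tendsto (fun n => ℓ k (x n)) atTop (𝓝 (charCoord ℓ φ k)) :=
    H.tendsto_coord_seqTrunc _
  have hterm : ∀ m, Tendsto (fun n => taylorForm (zeroExt f.1) m fun _ => x n) atTop
      (𝓝 (taylorExt f.1 ζ m)) := fun m => by
    have : taylorExt f.1 ζ m = aronBerner ζ m (taylorForm (zeroExt f.1) m) := by
      rw [taylorForm, map_smul]
      rfl
    rw [this]
    exact H.tendsto_aronBerner (fun n => (hx1 n).le) (fun k => hζ k ▸ hcoord k) _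
  obtain ⟨s, hs, hsρ⟩ := exists_gt_mul_lt_one ((one_mul ρ).trans_lt hρ)
  have hbound : ∀ n m, ‖taylorForm (zeroExt f.1) m fun _ => x n‖ ≤ ‖f‖ * s⁻¹ ^ m := fun n m => by
    rw [inv_pow, ← div_eq_mul_inv]
    exact norm_taylorForm_le (Au.analyticOnNhd f) (Au.norm_zeroExt_le f) (one_pos.trans hs)
      ((mul_le_mul_of_nonneg_left (hx n) (one_pos.trans hs).le).trans_lt hsρ) m
  have hsum : Summable fun m : ℕ => ‖f‖ * s⁻¹ ^ m :=
    (summable_geometric_of_lt_one (by positivity) (inv_lt_one_of_one_lt₀ hs)).mul_left _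
  have hsummable : Summable (taylorExt f.1 ζ) := Summable.of_norm_bounded hsum fun m =>
    le_of_tendsto (hterm m).norm (Eventually.of_forall fun n => hbound n m)
  have hlim : Tendsto (fun n => f.1 ⟨x n, mem_ball_zero_iff.2 (hx1 n)⟩) atTop
      (𝓝 (∑' m, taylorExt f.1 ζ m)) := by
    refine (tendsto_tsum_of_dominated_convergence hsum hterm
      (Eventually.of_forall fun n => hbound n)).congr fun n => ?_
    rw [(hasSum_taylorForm (Au.analyticOnNhd f) (hx1 n)).tsum_eq, zeroExt_eq]
  have hφ : Tendsto (fun n => f.1 ⟨x n, mem_ball_zero_iff.2 (hx1 n)⟩) atTop (𝓝 (φ f)) :=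
    H.tendsto_apply_of_tendsto_charCoord (φ := fun n => evalChar X ⟨x n, _⟩) hcoord f
  rw [tendsto_nhds_unique hφ hlim]
  exact hsummable.hasSum

end IsCZeroBasis

end AronBerner

/-- The coordinate functionals of `c₀`. -/
def CZero.coordL (n : ℕ) : StrongDual ℂ CZero :=
  LinearMap.mkContinuous
    { toFun := fun x : CZero => x n
      map_add' := fun _ _ => rfl
      map_smul' := fun _ _ => rfl } 1 (fun x => by
        rw [one_mul, ← ZeroAtInftyContinuousMap.norm_toBCF_eq_norm]
        exact x.toBCF.norm_coe_le_norm n)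

theorem CZero.coordL_unitVec (k n : ℕ) : CZero.coordL k (unitVec n) = if k = n then 1 else 0 :=
  Pi.single_apply n 1 k

theorem isCZeroBasis_unitVec : IsCZeroBasis unitVec CZero.coordL where
  coord_unit := CZero.coordL_unitVec
  norm_coord_le i x := by
    rw [← ZeroAtInftyContinuousMap.norm_toBCF_eq_norm]
    exact x.toBCF.norm_coe_le_norm i
  norm_le x C hC h := by
    rw [← ZeroAtInftyContinuousMap.norm_toBCF_eq_norm, BoundedContinuousFunction.norm_le hC]
    exact h
  tendsto_coord x := by
    have := x.zero_at_infty'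
    rwa [Filter.cocompact_eq_cofinite, Nat.cofinite_eq_atTop] at this

theorem LInf.norm_apply_le (z : LInf) (k : ℕ) : ‖z k‖ ≤ ‖z‖ :=
  lp.norm_apply_le_norm ENNReal.top_ne_zero z k

theorem LInf.norm_le {z : LInf} {C : ℝ} (hC : 0 ≤ C) (h : ∀ k, ‖z k‖ ≤ C) : ‖z‖ ≤ C :=
  lp.norm_le_of_forall_le hC h

namespace ClosedBallLInf

theorem norm_apply_le (z : ClosedBallLInf) (k : ℕ) : ‖z.1 k‖ ≤ 1 :=
  (LInf.norm_apply_le z.1 k).trans (mem_closedBall_zero_iff.1 z.2)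

/-- The point of the closed ball of `ℓ_∞` with given coordinates. -/
def mk (w : ℕ → ℂ) (hw : ∀ n, ‖w n‖ ≤ 1) : ClosedBallLInf :=
  ⟨⟨w, memℓp_infty ⟨1, by rintro _ ⟨n, rfl⟩; exact hw n⟩⟩,
    mem_closedBall_zero_iff.2 (LInf.norm_le zero_le_one hw)⟩

theorem ext {z w : ClosedBallLInf} (h : ∀ n, z.1 n = w.1 n) : z = w :=
  Subtype.ext (lp.ext (funext h))

end ClosedBallLInf

theorem toBidual_coordL (z : LInf) (k : ℕ) : toBidual z (CZero.coordL k) = z k := by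
  change ∑' n, z n * CZero.coordL k (unitVec n) = z k
  rw [tsum_eq_single k fun n hn => by rw [CZero.coordL_unitVec, if_neg hn.symm, mul_zero],
    CZero.coordL_unitVec, if_pos rfl, mul_one]

theorem exists_charCoord_eq (z : ClosedBallLInf) :
    ∃ φ : SpecC0, charCoord CZero.coordL φ = z.1 :=
  isCZeroBasis_unitVec.range_charCoord.ge z.norm_apply_le

/-- The evaluation `δ_z` at a point `z` of the closed ball of `ℓ_∞`, defined as the character with
the coordinates of `z`. -/
def pointEval (z : ClosedBallLInf) : SpecC0 := (exists_charCoord_eq z).choose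

theorem charCoord_pointEval (z : ClosedBallLInf) : charCoord CZero.coordL (pointEval z) = z.1 :=
  (exists_charCoord_eq z).choose_spec

theorem pointEval_ofDual_coordL (z : ClosedBallLInf) (k : ℕ) :
    pointEval z (Au.ofDual (CZero.coordL k)) = z.1 k :=
  congrFun (charCoord_pointEval z) k

theorem pointEval_eq_of_charCoord_eq {z : ClosedBallLInf} {φ : SpecC0}
    (h : ∀ k, charCoord CZero.coordL φ k = z.1 k) : pointEval z = φ :=
  isCZeroBasis_unitVec.injective_charCoord ((charCoord_pointEval z).trans (funext h).symm)

theorem pointEval_injective : Function.Injective pointEval := fun z w h =>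
  ClosedBallLInf.ext fun n => by
    rw [← pointEval_ofDual_coordL z, ← pointEval_ofDual_coordL w, h]

theorem exists_pointEval_eq (φ : SpecC0) : ∃ z : ClosedBallLInf, pointEval z = φ :=
  ⟨ClosedBallLInf.mk (charCoord CZero.coordL φ) (isCZeroBasis_unitVec.norm_charCoord_le_one φ),
    pointEval_eq_of_charCoord_eq fun _ => rfl⟩

theorem uniformContinuous_pointEval (f : Au CZero) :
    UniformContinuous fun z : ClosedBallLInf => pointEval z f := by
  refine Metric.uniformContinuous_iff_le.2 fun ε hε => ?_
  obtain ⟨d, hd, h⟩ := isCZeroBasis_unitVec.exists_forall_norm_sub_le f hε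
  refine ⟨d / 2, half_pos hd, fun z w hzw => (dist_eq_norm _ _).trans_le (h _ _ fun k => ?_)⟩
  rw [charCoord_pointEval, charCoord_pointEval]
  exact ((LInf.norm_apply_le (z.1 - w.1) k).trans ((dist_eq_norm _ _).ge.trans hzw)).trans_lt
    (half_lt_self hd)

theorem isPointEvaluation_pointEval : IsPointEvaluation pointEval := fun f =>
  ⟨uniformContinuous_pointEval f, fun w =>
    isCZeroBasis_unitVec.hasSum_taylorExt (ρ := ‖w.1‖)
      (fun k => by rw [toBidual_coordL, charCoord_pointEval]; rfl) (mem_ball_zero_iff.1 w.2)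
      (fun k => by rw [charCoord_pointEval]; exact LInf.norm_apply_le w.1 k) f⟩

section PseudoHyp

variable {A : Type*} [NormedRing A] [NormedAlgebra ℂ A]

theorem norm_le_pseudoHyp (φ ψ : characterSpace ℂ A) {f : A} (hf : ‖f‖ ≤ 1) (h : ψ f = 0) :
    ‖φ f‖ ≤ pseudoHyp φ ψ := by
  refine le_csSup ⟨1, ?_⟩ ⟨f, hf, h, rfl⟩
  rintro _ ⟨g, hg, -, rfl⟩
  exact (character_norm_apply_le φ g).trans hg

theorem pseudoHyp_nonneg (φ ψ : characterSpace ℂ A) : 0 ≤ pseudoHyp φ ψ :=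
  (norm_nonneg _).trans
    (norm_le_pseudoHyp φ ψ (f := 0) (norm_zero.trans_le zero_le_one) (map_zero ψ))

theorem pseudoHyp_le {φ ψ : characterSpace ℂ A} {ρ : ℝ}
    (h : ∀ f : A, ‖f‖ ≤ 1 → ψ f = 0 → ‖φ f‖ ≤ ρ) : pseudoHyp φ ψ ≤ ρ := by
  refine csSup_le ⟨_, 0, norm_zero.trans_le zero_le_one, map_zero ψ, rfl⟩ ?_
  rintro _ ⟨f, hf, hf0, rfl⟩
  exact h f hf hf0

theorem norm_le_pseudoHyp_mul (φ ψ : characterSpace ℂ A) {f : A} (h : ψ f = 0) :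
    ‖φ f‖ ≤ pseudoHyp φ ψ * ‖f‖ := by
  rcases eq_or_ne f 0 with rfl | hf
  · simp
  have hpos : 0 < ‖f‖ := norm_pos_iff.2 hf
  have hunit := norm_le_pseudoHyp φ ψ (f := (‖f‖ : ℂ)⁻¹ • f)
    (by rw [norm_smul, norm_inv, Complex.norm_real, norm_norm, inv_mul_cancel₀ hpos.ne'])
    (by rw [map_smul, h, smul_zero])
  rwa [map_smul, norm_smul, norm_inv, Complex.norm_real, norm_norm, inv_mul_le_iff₀' hpos] at hunit

theorem gleasonDist_le_of_forall {φ ψ : characterSpace ℂ A} {D : ℝ} (hD : 0 ≤ D)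
    (h : ∀ f, ‖φ f - ψ f‖ ≤ D * ‖f‖) : gleasonDist φ ψ ≤ D :=
  ContinuousLinearMap.opNorm_le_bound _ hD h

theorem norm_sub_le_gleasonDist_mul (φ ψ : characterSpace ℂ A) (f : A) :
    ‖φ f - ψ f‖ ≤ gleasonDist φ ψ * ‖f‖ :=
  (toDual φ - toDual ψ).le_opNorm f

theorem gleasonDist_le_two_mul_pseudoHyp [NormOneClass A] (φ ψ : characterSpace ℂ A) :
    gleasonDist φ ψ ≤ 2 * pseudoHyp φ ψ := by
  have hρ := pseudoHyp_nonneg φ ψ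
  refine gleasonDist_le_of_forall (mul_nonneg zero_le_two hρ) fun f => ?_
  have hker : ψ (f - algebraMap ℂ A (ψ f)) = 0 := by
    rw [map_sub, AlgHomClass.commutes ψ, Algebra.algebraMap_self_apply, sub_self]
  have hnorm : ‖f - algebraMap ℂ A (ψ f)‖ ≤ 2 * ‖f‖ := calc
    _ ≤ ‖f‖ + ‖algebraMap ℂ A (ψ f)‖ := norm_sub_le _ _
    _ = ‖f‖ + ‖ψ f‖ := by rw [norm_algebraMap']
    _ ≤ 2 * ‖f‖ := by linarith [character_norm_apply_le ψ f]
  calc ‖φ f - ψ f‖ = ‖φ (f - algebraMap ℂ A (ψ f))‖ := by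
        rw [map_sub, AlgHomClass.commutes φ, Algebra.algebraMap_self_apply]
    _ ≤ pseudoHyp φ ψ * (2 * ‖f‖) :=
        (norm_le_pseudoHyp_mul φ ψ hker).trans (mul_le_mul_of_nonneg_left hnorm hρ)
    _ = 2 * pseudoHyp φ ψ * ‖f‖ := by ring

theorem pseudoHyp_le_norm_of_differentiableOn {χ : ℂ → characterSpace ℂ A}
    (hχ : ∀ f, DifferentiableOn ℂ (fun t => χ t f) (ball 0 1)) {c : ℂ} (hc : ‖c‖ < 1) :
    pseudoHyp (χ c) (χ 0) ≤ ‖c‖ := by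
  refine pseudoHyp_le fun f hf hf0 => ?_
  refine Complex.norm_le_norm_of_mapsTo_ball (hχ f) (fun t _ => ?_) hf0 hc
  exact mem_closedBall_zero_iff.2 ((character_norm_apply_le _ _).trans hf)

end PseudoHyp

section SchwarzPick

theorem norm_one_sub_conj_mul_sq_sub (a b : ℂ) :
    ‖1 - star b * a‖ ^ 2 - ‖a - b‖ ^ 2 = (1 - ‖a‖ ^ 2) * (1 - ‖b‖ ^ 2) := by
  simp only [Complex.sq_norm, Complex.normSq_apply, Complex.star_def, Complex.sub_re,
    Complex.sub_im, Complex.mul_re, Complex.mul_im, Complex.conj_re, Complex.conj_im,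
    Complex.one_re, Complex.one_im]
  ring

theorem norm_sub_le_norm_one_sub_conj_mul {a b : ℂ} (ha : ‖a‖ ≤ 1) (hb : ‖b‖ ≤ 1) :
    ‖a - b‖ ≤ ‖1 - star b * a‖ := by
  have hprod : 0 ≤ (1 - ‖a‖ ^ 2) * (1 - ‖b‖ ^ 2) :=
    mul_nonneg (sub_nonneg.2 (pow_le_one₀ (norm_nonneg a) ha))
      (sub_nonneg.2 (pow_le_one₀ (norm_nonneg b) hb))
  exact le_of_sq_le_sq (by linarith [norm_one_sub_conj_mul_sq_sub a b]) (norm_nonneg _)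

theorem norm_conj_mul_le_one {a b : ℂ} (ha : ‖a‖ ≤ 1) (hb : ‖b‖ ≤ 1) : ‖star b * a‖ ≤ 1 := by
  rw [norm_mul, norm_star]
  exact mul_le_one₀ hb (norm_nonneg a) ha

theorem norm_le_norm_add_ofReal {s : ℂ} (hs : 0 ≤ s.re) {ε : ℝ} (hε : 0 ≤ ε) :
    ‖s‖ ≤ ‖s + ε‖ := by
  refine le_of_sq_le_sq ?_ (norm_nonneg _)
  simp only [Complex.sq_norm, Complex.normSq_apply, Complex.add_re, Complex.add_im,
    Complex.ofReal_re, Complex.ofReal_im]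
  nlinarith

theorem exists_differentiableOn_ball_eq_of_norm_sub_le {a b : ℂ} (hb : ‖b‖ ≤ 1) {ρ : ℝ}
    (hρ0 : 0 ≤ ρ) (hρ1 : ρ < 1) (h : ‖a - b‖ ≤ ρ * ‖1 - star b * a‖) :
    ∃ g : ℂ → ℂ, DifferentiableOn ℂ g (ball 0 1) ∧ (∀ t ∈ ball (0 : ℂ) 1, ‖g t‖ ≤ 1) ∧
      g 0 = b ∧ g ρ = a := by
  have hρn : ‖(ρ : ℂ)‖ = ρ := by rw [Complex.norm_real, Real.norm_of_nonneg hρ0]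
  have hle : ‖a - b‖ ≤ ‖ρ * (1 - star b * a)‖ := by rwa [norm_mul, hρn]
  set κ : ℂ := (a - b) / (ρ * (1 - star b * a)) with hκ_def
  have hκ : ‖κ‖ ≤ 1 := by
    rw [norm_div]
    exact div_le_one_of_le₀ hle (norm_nonneg _)
  have hκρ : κ * (ρ * (1 - star b * a)) = a - b :=
    div_mul_cancel_of_imp fun h0 => norm_le_zero_iff.1 (by rwa [h0, norm_zero] at hle)
  have hκt : ∀ t ∈ ball (0 : ℂ) 1, ‖κ * t‖ < 1 := fun t ht => by
    rw [norm_mul]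
    exact (mul_le_of_le_one_left (norm_nonneg t) hκ).trans_lt (mem_ball_zero_iff.1 ht)
  have hden : ∀ t ∈ ball (0 : ℂ) 1, 1 + star b * (κ * t) ≠ 0 := fun t ht h0 => by
    have hone : ‖star b * (κ * t)‖ = 1 := by rw [eq_neg_of_add_eq_zero_right h0, norm_neg, norm_one]
    rw [norm_mul, norm_star] at hone
    exact ((mul_le_of_le_one_left (norm_nonneg _) hb).trans_lt (hκt t ht)).ne hone
  refine ⟨fun t => (κ * t + b) / (1 + star b * (κ * t)),
    DifferentiableOn.fun_div (by fun_prop) (by fun_prop) hden, fun t ht => ?_, by simp, ?_⟩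
  · have hnb : ‖-b‖ ≤ 1 := (norm_neg b).trans_le hb
    have hmoeb := norm_sub_le_norm_one_sub_conj_mul (hκt t ht).le hnb
    rw [sub_neg_eq_add, star_neg, neg_mul, sub_neg_eq_add] at hmoeb
    rw [norm_div]
    exact div_le_one_of_le₀ hmoeb (norm_nonneg _)
  · rw [div_eq_iff (hden ρ (mem_ball_zero_iff.2 (hρn.trans_lt hρ1)))]
    linear_combination hκρ

variable {X : Type*} [NormedAddCommGroup X] [NormedSpace ℂ X] {e : ℕ → X} {ℓ : ℕ → StrongDual ℂ X}

namespace IsCZeroBasis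

theorem differentiableOn_apply (H : IsCZeroBasis e ℓ) {χ : ℂ → characterSpace ℂ (Au X)}
    {U : Set ℂ} (hU : IsOpen U) (hχ : ∀ k, DifferentiableOn ℂ (fun t => charCoord ℓ (χ t) k) U)
    (f : Au X) : DifferentiableOn ℂ (fun t => χ t f) U := by
  have hpoly : ∀ q ∈ coordPoly ℓ, DifferentiableOn ℂ (fun t => χ t q) U := by
    intro q hq
    induction hq using Algebra.adjoin_induction with
    | mem x hx =>
      obtain ⟨k, rfl⟩ := hx
      exact hχ k
    | algebraMap c =>
      exact (differentiableOn_const c).congr fun t _ => AlgHomClass.commutes (χ t) c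
    | add x y _ _ hx hy => simpa only [map_add] using hx.fun_add hy
    | mul x y _ _ hx hy => simpa only [map_mul] using hx.fun_mul hy
  obtain ⟨q, hq, hqf⟩ := mem_closure_iff_seq_limit.1 (dense_coordPoly H f)
  have hunif : TendstoUniformlyOn (fun n t => χ t (q n)) (fun t => χ t f) atTop U := by
    refine Metric.tendstoUniformlyOn_iff.2 fun ε hε => ?_
    filter_upwards [Metric.tendsto_nhds.1 hqf ε hε] with n hn t _
    rw [dist_comm, dist_eq_norm, ← map_sub]
    exact (character_norm_apply_le _ _).trans_lt ((dist_eq_norm (q n) f).ge.trans_lt hn)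
  exact hunif.tendstoLocallyUniformlyOn.differentiableOn
    (Eventually.of_forall fun n => hpoly _ (hq n)) hU

theorem exists_forall_apply_eq (H : IsCZeroBasis e ℓ) (k : ℕ) {U : Set ℂ} (hU : IsOpen U)
    (hU1 : closedBall 0 1 ⊆ U) {G : ℂ → ℂ} (hG : DifferentiableOn ℂ G U)
    (hG1 : ∀ t ∈ closedBall (0 : ℂ) 1, ‖G t‖ ≤ 1) :
    ∃ f : Au X, ‖f‖ ≤ 1 ∧ ∀ φ : characterSpace ℂ (Au X), φ f = G (charCoord ℓ φ k) := by
  have hmaps : MapsTo (ℓ k) (ball 0 1) (closedBall 0 1) := fun x hx =>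
    mem_closedBall_zero_iff.2 ((H.norm_coord_le k x).trans (mem_ball_zero_iff.1 hx).le)
  have hGc : ContinuousOn G (closedBall 0 1) := hG.continuousOn.mono hU1
  let f : Au X := Au.ofFun (fun x => G (ℓ k x))
    ((hG.analyticOnNhd hU).comp ((ℓ k).analyticOnNhd _) (hmaps.mono_right hU1))
    (((ProperSpace.isCompact_closedBall _ _).uniformContinuousOn_of_continuous hGc).comp
      (ℓ k).uniformContinuous.uniformContinuousOn hmaps) 1
    fun x hx => hG1 _ (hmaps hx)
  refine ⟨f, Au.norm_le_of_forall fun x => hG1 _ (hmaps x.2), fun φ => ?_⟩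
  have hφ : charCoord ℓ φ k ∈ closedBall (0 : ℂ) 1 :=
    mem_closedBall_zero_iff.2 (H.norm_charCoord_le_one φ k)
  refine tendsto_nhds_unique (H.tendsto_approxPt φ f) ((hGc _ hφ).tendsto.comp
    (tendsto_nhdsWithin_iff.2 ⟨H.tendsto_coord_approxPt (H.norm_charCoord_le_one φ) k, ?_⟩))
  exact Eventually.of_forall fun n => hmaps (Subtype.coe_prop _)

variable {φ ψ : characterSpace ℂ (Au X)} {ρ : ℝ}

theorem pseudoHyp_le_of_forall (H : IsCZeroBasis e ℓ) (hρ0 : 0 ≤ ρ) (hρ1 : ρ < 1)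
    (h : ∀ k, ‖charCoord ℓ φ k - charCoord ℓ ψ k‖ ≤
      ρ * ‖1 - star (charCoord ℓ ψ k) * charCoord ℓ φ k‖) : pseudoHyp φ ψ ≤ ρ := by
  choose g hg hg1 hg0 hgρ using fun k =>
    exists_differentiableOn_ball_eq_of_norm_sub_le (H.norm_charCoord_le_one ψ k) hρ0 hρ1 (h k)
  have hρn : ‖(ρ : ℂ)‖ = ρ := by rw [Complex.norm_real, Real.norm_of_nonneg hρ0]
  have hχ : ∀ t : ℂ, ∃ χ : characterSpace ℂ (Au X),
      t ∈ ball (0 : ℂ) 1 → charCoord ℓ χ = fun k => g k t := fun t => by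
    by_cases ht : t ∈ ball (0 : ℂ) 1
    · obtain ⟨χ, hχ⟩ := H.range_charCoord.ge fun k => hg1 k t ht
      exact ⟨χ, fun _ => hχ⟩
    · exact ⟨φ, fun h => absurd h ht⟩
  choose χ hχ using hχ
  have hχ0 : χ 0 = ψ := H.injective_charCoord <|
    (hχ 0 (mem_ball_self one_pos)).trans (funext hg0)
  have hχρ : χ ρ = φ := H.injective_charCoord <|
    (hχ ρ (mem_ball_zero_iff.2 (hρn.trans_lt hρ1))).trans (funext hgρ)
  have hschwarz : pseudoHyp (χ ρ) (χ 0) ≤ ‖(ρ : ℂ)‖ := by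
    refine pseudoHyp_le_norm_of_differentiableOn (H.differentiableOn_apply isOpen_ball fun k => ?_)
      (hρn.trans_lt hρ1)
    exact (hg k).congr fun t ht => congrFun (hχ t ht) k
  rwa [hχ0, hχρ, hρn] at hschwarz

theorem norm_charCoord_sub_le_pseudoHyp_mul (H : IsCZeroBasis e ℓ) (k : ℕ) :
    ‖charCoord ℓ φ k - charCoord ℓ ψ k‖ ≤
      pseudoHyp φ ψ * ‖1 - star (charCoord ℓ ψ k) * charCoord ℓ φ k‖ := by
  set a := charCoord ℓ φ k
  set b := charCoord ℓ ψ k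
  have hb : ‖b‖ ≤ 1 := H.norm_charCoord_le_one ψ k
  have hre : ∀ t : ℂ, ‖t‖ ≤ 1 → 0 ≤ (1 - star b * t).re := fun t ht => by
    rw [Complex.sub_re, Complex.one_re, sub_nonneg]
    exact (Complex.re_le_norm _).trans (norm_conj_mul_le_one ht hb)
  have hne : ∀ ε : ℝ, 0 < ε → ∀ t : ℂ, ‖t‖ ≤ 1 → 1 - star b * t + ε ≠ 0 := fun ε hε t ht h0 => by
    have h := congrArg Complex.re h0
    rw [Complex.add_re, Complex.ofReal_re, Complex.zero_re] at h
    linarith [hre t ht]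
  -- The perturbation by `ε` keeps the denominator of the Möbius function away from zero on the
  -- closed disc also when `b` is unimodular.
  have hε : ∀ ε : ℝ, 0 < ε → ‖a - b‖ ≤ pseudoHyp φ ψ * ‖1 - star b * a + ε‖ := fun ε hε => by
    obtain ⟨f, hf, hfφ⟩ := H.exists_forall_apply_eq k (U := {t | 1 - star b * t + ε ≠ 0})
      (isOpen_ne_fun (by fun_prop) continuous_const)
      (fun t ht => hne ε hε t (mem_closedBall_zero_iff.1 ht))
      (G := fun t => (t - b) / (1 - star b * t + ε))
      (DifferentiableOn.fun_div (by fun_prop) (by fun_prop) fun t ht => ht) fun t ht => by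
        rw [mem_closedBall_zero_iff] at ht
        rw [norm_div]
        exact div_le_one_of_le₀ ((norm_sub_le_norm_one_sub_conj_mul ht hb).trans
          (norm_le_norm_add_ofReal (hre t ht) hε.le)) (norm_nonneg _)
    have h := norm_le_pseudoHyp φ ψ hf (by rw [hfφ, sub_self, zero_div])
    rwa [hfφ, norm_div,
      div_le_iff₀ (norm_pos_iff.2 (hne ε hε a (H.norm_charCoord_le_one φ k)))] at h
  have hcont : Continuous fun ε : ℝ => pseudoHyp φ ψ * ‖1 - star b * a + ε‖ := by fun_prop
  have hlim := (hcont.tendsto 0).mono_left (nhdsWithin_le_nhds (s := Ioi 0))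
  rw [Complex.ofReal_zero, add_zero] at hlim
  exact ge_of_tendsto hlim (eventually_nhdsWithin_of_forall hε)

theorem pseudoHyp_le_iff (H : IsCZeroBasis e ℓ) (hρ : 0 ≤ ρ) :
    pseudoHyp φ ψ ≤ ρ ↔ ∀ k, ‖charCoord ℓ φ k - charCoord ℓ ψ k‖ ≤
      ρ * ‖1 - star (charCoord ℓ ψ k) * charCoord ℓ φ k‖ := by
  refine ⟨fun h k => (H.norm_charCoord_sub_le_pseudoHyp_mul k).trans
    (mul_le_mul_of_nonneg_right h (norm_nonneg _)), fun h => ?_⟩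
  rcases lt_or_ge ρ 1 with hρ1 | hρ1
  · exact H.pseudoHyp_le_of_forall hρ hρ1 h
  · exact pseudoHyp_le fun f hf _ => ((character_norm_apply_le φ f).trans hf).trans hρ1

theorem mem_gleasonPart_iff (H : IsCZeroBasis e ℓ) :
    ψ ∈ gleasonPart φ ↔ ∃ ρ : ℝ, 0 ≤ ρ ∧ ρ < 1 ∧ ∀ k, ‖charCoord ℓ φ k - charCoord ℓ ψ k‖ ≤
      ρ * ‖1 - star (charCoord ℓ ψ k) * charCoord ℓ φ k‖ := by
  constructor
  · exact fun h => ⟨_, pseudoHyp_nonneg φ ψ, h, H.norm_charCoord_sub_le_pseudoHyp_mul⟩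
  rintro ⟨ρ, hρ0, hρ1, h⟩
  exact ((H.pseudoHyp_le_iff hρ0).2 h).trans_lt hρ1

end IsCZeroBasis

end SchwarzPick

section GleasonPart

theorem norm_sub_le_mul_norm_one_sub_conj_mul {a b : ℂ} {r : ℝ} (hr : r < 1) (ha : ‖a‖ ≤ r)
    (hb : ‖b‖ ≤ r) : ‖a - b‖ ≤ 2 * r / (1 + r ^ 2) * ‖1 - star b * a‖ := by
  have hr0 : 0 ≤ r := (norm_nonneg a).trans ha
  have hprod : (1 - r ^ 2) * (1 - r ^ 2) ≤ (1 - ‖a‖ ^ 2) * (1 - ‖b‖ ^ 2) := by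
    have hr2 : 0 ≤ 1 - r ^ 2 := sub_nonneg.2 (pow_le_one₀ hr0 hr.le)
    exact mul_le_mul (by gcongr) (by gcongr) hr2 (hr2.trans (by gcongr))
  have hupper : ‖1 - star b * a‖ ≤ 1 + r ^ 2 := calc
    _ ≤ 1 + ‖b‖ * ‖a‖ := by
      simpa only [norm_one, norm_mul, norm_star] using norm_sub_le 1 (star b * a)
    _ ≤ 1 + r ^ 2 := by rw [sq]; gcongr
  rw [div_mul_eq_mul_div, le_div_iff₀ (by positivity)]
  refine le_of_sq_le_sq ?_ (by positivity)
  nlinarith [norm_one_sub_conj_mul_sq_sub a b, pow_le_pow_left₀ (norm_nonneg _) hupper 2]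

theorem eq_of_norm_sub_le_mul {a b : ℂ} (ha : ‖a‖ = 1) {ρ : ℝ} (hρ : ρ < 1)
    (h : ‖a - b‖ ≤ ρ * ‖1 - star b * a‖) : a = b := by
  have heq : ‖1 - star b * a‖ = ‖a - b‖ := by
    have hsq := norm_one_sub_conj_mul_sq_sub a b
    rw [ha, one_pow, sub_self, zero_mul, sub_eq_zero] at hsq
    exact (pow_left_inj₀ (norm_nonneg _) (norm_nonneg _) two_ne_zero).1 hsq
  rw [heq] at h
  exact sub_eq_zero.1 (norm_le_zero_iff.1 (by nlinarith [norm_nonneg (a - b)]))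

theorem exists_lt_one_forall_norm_le {r ρ : ℝ} (hr : r < 1) (hρ0 : 0 ≤ ρ) (hρ1 : ρ < 1) :
    ∃ s < 1, ∀ a b : ℂ, ‖a‖ ≤ r → ‖b‖ ≤ 1 → ‖a - b‖ ≤ ρ * ‖1 - star b * a‖ → ‖b‖ ≤ s := by
  have hρ2 : 0 < 1 - ρ ^ 2 := sub_pos.2 (pow_lt_one₀ hρ0 hρ1 two_ne_zero)
  refine ⟨√(1 - (1 - ρ ^ 2) * (1 - r) ^ 2), ?_, fun a b ha hb h => Real.le_sqrt_of_sq_le ?_⟩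
  · rw [Real.sqrt_lt' one_pos]
    linarith [mul_pos hρ2 (pow_pos (sub_pos.2 hr) 2)]
  · have hlower : 1 - r ≤ ‖1 - star b * a‖ := calc
      1 - r ≤ 1 - ‖b‖ * ‖a‖ := by nlinarith [norm_nonneg a]
      _ ≤ ‖1 - star b * a‖ := by
        simpa only [norm_one, norm_mul, norm_star] using norm_sub_norm_le 1 (star b * a)
    have hb2 : 0 ≤ 1 - ‖b‖ ^ 2 := sub_nonneg.2 (pow_le_one₀ (norm_nonneg b) hb)
    have hprod : (1 - ρ ^ 2) * (1 - r) ^ 2 ≤ 1 - ‖b‖ ^ 2 := calc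
      _ ≤ (1 - ρ ^ 2) * ‖1 - star b * a‖ ^ 2 :=
        mul_le_mul_of_nonneg_left (pow_le_pow_left₀ (sub_nonneg.2 hr.le) hlower 2) hρ2.le
      _ ≤ (1 - ‖a‖ ^ 2) * (1 - ‖b‖ ^ 2) := by
        have hsq := pow_le_pow_left₀ (norm_nonneg _) h 2
        rw [← norm_one_sub_conj_mul_sq_sub, mul_pow] at *
        linarith
      _ ≤ 1 - ‖b‖ ^ 2 := mul_le_of_le_one_left hb2 (sub_le_self _ (sq_nonneg _))
    linarith

theorem pointEval_mem_gleasonPart_iff {z w : ClosedBallLInf} :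
    pointEval w ∈ gleasonPart (pointEval z) ↔ ∃ ρ : ℝ, 0 ≤ ρ ∧ ρ < 1 ∧
      ∀ n, ‖z.1 n - w.1 n‖ ≤ ρ * ‖1 - star (w.1 n) * z.1 n‖ := by
  simp only [isCZeroBasis_unitVec.mem_gleasonPart_iff, charCoord_pointEval]

theorem pointEval_mem_gleasonPart {z w : ClosedBallLInf} {r : ℝ} (hr : r < 1)
    (h : ∀ n, w.1 n = z.1 n ∨ (‖z.1 n‖ ≤ r ∧ ‖w.1 n‖ ≤ r)) :
    pointEval w ∈ gleasonPart (pointEval z) := by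
  have hs1 : max r 0 < 1 := max_lt hr one_pos
  have hρ : 0 ≤ 2 * max r 0 / (1 + max r 0 ^ 2) :=
    div_nonneg (mul_nonneg zero_le_two (le_max_right r 0)) (by positivity)
  refine pointEval_mem_gleasonPart_iff.2 ⟨_, hρ, ?_, fun n => ?_⟩
  · rw [div_lt_one (by positivity)]
    nlinarith [pow_pos (sub_pos.2 hs1) 2]
  · rcases h n with h | ⟨hz, hw⟩
    · rw [h, sub_self, norm_zero]
      exact mul_nonneg hρ (norm_nonneg _)
    · exact norm_sub_le_mul_norm_one_sub_conj_mul hs1 (hz.trans (le_max_left r 0))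
        (hw.trans (le_max_left r 0))

theorem gleasonPart_pointEval {z : ClosedBallLInf} {r : ℝ} (hr : r < 1)
    (hz : ∀ n ∈ (unimodularIdx z)ᶜ, ‖z.1 n‖ ≤ r) :
    gleasonPart (pointEval z) = {φ | ∃ w : ClosedBallLInf, φ = pointEval w ∧
      (∀ n ∈ unimodularIdx z, w.1 n = z.1 n) ∧
      ∃ r : ℝ, r < 1 ∧ ∀ n ∈ (unimodularIdx z)ᶜ, ‖w.1 n‖ ≤ r} := by
  refine Subset.antisymm (fun φ hφ => ?_) ?_
  · obtain ⟨w, rfl⟩ := exists_pointEval_eq φ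
    obtain ⟨ρ, hρ0, hρ1, h⟩ := pointEval_mem_gleasonPart_iff.1 hφ
    obtain ⟨s, hs, hws⟩ := exists_lt_one_forall_norm_le hr hρ0 hρ1
    exact ⟨w, rfl, fun n hn => (eq_of_norm_sub_le_mul hn hρ1 (h n)).symm, s, hs,
      fun n hn => hws _ _ (hz n hn) (w.norm_apply_le n) (h n)⟩
  · rintro _ ⟨w, rfl, hwz, r', hr', hw⟩
    refine pointEval_mem_gleasonPart (max_lt hr hr') fun n => ?_
    by_cases hn : n ∈ unimodularIdx z
    · exact Or.inl (hwz n hn)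
    · exact Or.inr ⟨(hz n hn).trans (le_max_left _ _), (hw n hn).trans (le_max_right _ _)⟩

end GleasonPart

section Isometry

variable {A B : Type*} [NormedRing A] [NormedAlgebra ℂ A] [NormedRing B] [NormedAlgebra ℂ B]

theorem gleasonDist_le_of_dense {φ φ' : characterSpace ℂ A} {χ χ' : characterSpace ℂ B}
    {S : Set A} (hS : Dense S) (h : ∀ q ∈ S, ∃ g : B, ‖g‖ ≤ ‖q‖ ∧ χ g = φ q ∧ χ' g = φ' q) :
    gleasonDist φ φ' ≤ gleasonDist χ χ' := by
  have hclosed : IsClosed {f | ‖φ f - φ' f‖ ≤ gleasonDist χ χ' * ‖f‖} :=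
    isClosed_le (toDual φ - toDual φ').continuous.norm (continuous_norm.const_mul _)
  refine gleasonDist_le_of_forall (norm_nonneg _) fun f => hclosed.closure_subset_iff.2 ?_ (hS f)
  intro q hq
  obtain ⟨g, hgq, hχ, hχ'⟩ := h q hq
  rw [mem_ofPred_eq, ← hχ, ← hχ']
  exact (norm_sub_le_gleasonDist_mul χ χ' g).trans
    (mul_le_mul_of_nonneg_left hgq (norm_nonneg _))

theorem exists_forall_apply_eq_of_mem_coordPoly {X U : Type*} [NormedAddCommGroup X]
    [NormedSpace ℂ X] {ℓ : ℕ → StrongDual ℂ X} {φ : U → characterSpace ℂ (Au X)}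
    {χ : U → characterSpace ℂ B} (h : ∀ k, ∃ g : B, ∀ u, χ u g = charCoord ℓ (φ u) k)
    {q : Au X} (hq : q ∈ coordPoly ℓ) : ∃ g : B, ∀ u, χ u g = φ u q := by
  have hle : coordPoly ℓ ≤
      (AlgHom.pi fun u => CharacterSpace.toAlgHom (χ u)).range.comap
        (AlgHom.pi fun u => CharacterSpace.toAlgHom (φ u)) := by
    refine Algebra.adjoin_le ?_
    rintro _ ⟨k, rfl⟩
    obtain ⟨g, hg⟩ := h k
    exact ⟨g, funext hg⟩
  obtain ⟨g, hg⟩ := hle hq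
  exact ⟨g, congrFun hg⟩

end Isometry

section CoordinateBall

/-- A family `χ` of characters of a Banach algebra `B`, indexed by points `u` with coordinates
`val u`, is a coordinate ball if it behaves like the evaluations of uniformly continuous holomorphic
functions at the points of the open unit ball of `ℓ_∞(ι)`. The last two conditions compare `B` with
`𝒜_u(B_{c₀})`: the coordinates are elements of `B`, and an element of `B` is, without increase of
the norm, a function of any choice of coordinates of `c₀`. The notion covers the polydisc and the
ball of `ℓ_∞`. -/
structure IsCoordinateBall {U ι B : Type*} [NormedRing B] [NormedAlgebra ℂ B] (val : U → ι → ℂ)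
    (χ : U → characterSpace ℂ B) : Prop where
  injective_val : Function.Injective val
  range_val : range val = {v | ∃ r < 1, ∀ i, ‖v i‖ ≤ r}
  norm_le : ∀ (g : B) (C : ℝ), (∀ u, ‖χ u g‖ ≤ C) → ‖g‖ ≤ C
  exists_apply_eq_val : ∀ i, ∃ g : B, ∀ u, χ u g = val u i
  exists_lift : ∀ e : ι → ℕ, Function.Injective e → ∀ g : B, ∃ f : Au CZero, ‖f‖ ≤ ‖g‖ ∧
    ∀ (u : U) (w : ClosedBallLInf), (∀ i, w.1 (e i) = val u i) → pointEval w f = χ u g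

theorem norm_le_of_forall_pointEval {g : Au CZero} {C : ℝ}
    (h : ∀ u : OpenBallLInf, ‖pointEval u.toClosed g‖ ≤ C) : ‖g‖ ≤ C := by
  refine Au.norm_le_of_forall fun x => ?_
  have hx : ∀ n, ‖CZero.coordL n x‖ ≤ ‖(x : CZero)‖ := fun n =>
    isCZeroBasis_unitVec.norm_coord_le n x
  have hx1 : ‖(x : CZero)‖ < 1 := mem_ball_zero_iff.1 x.2
  let z : ClosedBallLInf := .mk (fun n => CZero.coordL n x) fun n => (hx n).trans hx1.le
  have hz : pointEval z = evalChar CZero x := pointEval_eq_of_charCoord_eq fun _ => rfl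
  rw [← evalChar_apply, ← hz]
  exact h ⟨z.1, mem_ball_zero_iff.2 ((LInf.norm_le (norm_nonneg _) hx).trans_lt hx1)⟩

namespace Polydisc

variable {k : ℕ}

/-- The coordinates of `c₀` with indices `e 0, …, e (k - 1)`. -/
def coordProj (e : Fin k → ℕ) : CZero →L[ℂ] (Fin k → ℂ) :=
  ContinuousLinearMap.pi fun i => CZero.coordL (e i)

theorem norm_coordProj_le (e : Fin k → ℕ) (x : CZero) : ‖coordProj e x‖ ≤ ‖x‖ :=
  (pi_norm_le_iff_of_nonneg (norm_nonneg _)).2 fun i => isCZeroBasis_unitVec.norm_coord_le (e i) x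

theorem pointEval_compCLM_coordProj (e : Fin k → ℕ) (g : Au (Fin k → ℂ)) {u : Polydisc k}
    {w : ClosedBallLInf} (hw : ∀ i, w.1 (e i) = u.1 i) :
    pointEval w (Au.compCLM (coordProj e) (norm_coordProj_le e) g) =
      evalChar (Fin k → ℂ) u g := by
  refine tendsto_nhds_unique (isCZeroBasis_unitVec.tendsto_approxPt (pointEval w) _) ?_
  simp only [Au.compCLM_apply]
  refine (g.1.continuous.tendsto u).comp (tendsto_subtype_rng.2 (tendsto_pi_nhds.2 fun i => ?_))
  rw [← hw i, ← charCoord_pointEval w]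
  exact isCZeroBasis_unitVec.tendsto_coord_approxPt
    (isCZeroBasis_unitVec.norm_charCoord_le_one (pointEval w)) (e i)

theorem isCoordinateBall :
    IsCoordinateBall (fun u : Polydisc k => u.1) (evalChar (Fin k → ℂ)) where
  injective_val := Subtype.val_injective
  range_val := by
    ext v
    refine ⟨?_, fun ⟨r, hr, hv⟩ => ⟨⟨v, mem_ball_zero_iff.2 ?_⟩, rfl⟩⟩
    · rintro ⟨u, rfl⟩
      exact ⟨‖u.1‖, mem_ball_zero_iff.1 u.2, norm_le_pi_norm u.1⟩
    · exact (pi_norm_lt_iff one_pos).2 fun i => (hv i).trans_lt hr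
  norm_le _ _ := Au.norm_le_of_forall
  exists_apply_eq_val i := ⟨Au.ofDual (ContinuousLinearMap.proj i), fun _ => rfl⟩
  exists_lift e _ g := ⟨_, Au.norm_compCLM_le _ (norm_coordProj_le e) g, fun _ _ hw =>
    pointEval_compCLM_coordProj e g hw⟩

end Polydisc

namespace OpenBallLInf

variable {e : ℕ → ℕ} (he : Function.Injective e)

/-- The coordinates of `c₀` with indices `e 0, e 1, …`. -/
def coordProj : CZero →L[ℂ] CZero :=
  LinearMap.mkContinuous
    { toFun := fun x : CZero =>
        { toFun := fun n => x (e n)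
          continuous_toFun := continuous_of_discreteTopology
          zero_at_infty' := by
            have h := x.zero_at_infty'
            rw [Filter.cocompact_eq_cofinite] at h ⊢
            exact h.comp he.tendsto_cofinite }
      map_add' := fun _ _ => rfl
      map_smul' := fun _ _ => rfl } 1 fun x => by
    rw [one_mul]
    exact isCZeroBasis_unitVec.norm_le _ _ (norm_nonneg _) fun i =>
      isCZeroBasis_unitVec.norm_coord_le (e i) x

theorem norm_coordProj_le (x : CZero) : ‖coordProj he x‖ ≤ ‖x‖ :=
  isCZeroBasis_unitVec.norm_le _ _ (norm_nonneg _) fun i =>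
    isCZeroBasis_unitVec.norm_coord_le (e i) x

theorem pointEval_compCLM_coordProj (g : Au CZero) {u w : ClosedBallLInf}
    (hw : ∀ i, w.1 (e i) = u.1 i) :
    pointEval w (Au.compCLM (coordProj he) (norm_coordProj_le he) g) = pointEval u g := by
  refine tendsto_nhds_unique (isCZeroBasis_unitVec.tendsto_approxPt (pointEval w) _) ?_
  simp only [Au.compCLM_apply]
  refine isCZeroBasis_unitVec.tendsto_apply_of_tendsto_charCoord
    (φ := fun n => evalChar CZero _) (fun i => ?_) g
  have hcoord : charCoord CZero.coordL (pointEval u) i =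
      charCoord CZero.coordL (pointEval w) (e i) := by
    rw [charCoord_pointEval, charCoord_pointEval, hw]
  rw [hcoord]
  exact isCZeroBasis_unitVec.tendsto_coord_approxPt
    (isCZeroBasis_unitVec.norm_charCoord_le_one (pointEval w)) (e i)

theorem isCoordinateBall :
    IsCoordinateBall (fun u : OpenBallLInf => (u.1 : ℕ → ℂ)) fun u => pointEval u.toClosed where
  injective_val _ _ h := Subtype.ext (lp.ext h)
  range_val := by
    ext v
    refine ⟨?_, fun ⟨r, hr, hv⟩ => ?_⟩
    · rintro ⟨u, rfl⟩
      exact ⟨‖u.1‖, mem_ball_zero_iff.1 u.2, LInf.norm_apply_le u.1⟩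
    · let w : ClosedBallLInf := .mk v fun n => (hv n).trans hr.le
      have hw : ‖w.1‖ ≤ r := LInf.norm_le ((norm_nonneg _).trans (hv 0)) hv
      exact ⟨⟨w.1, mem_ball_zero_iff.2 (hw.trans_lt hr)⟩, rfl⟩
  norm_le _ _ := norm_le_of_forall_pointEval
  exists_apply_eq_val i := ⟨Au.ofDual (CZero.coordL i), fun u =>
    pointEval_ofDual_coordL u.toClosed i⟩
  exists_lift _ he g := ⟨_, Au.norm_compCLM_le _ (norm_coordProj_le he) g, fun _ _ hw =>
    pointEval_compCLM_coordProj he g hw⟩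

end OpenBallLInf

end CoordinateBall

section ReplaceCoord

namespace ClosedBallLInf

variable {ι : Type*} {e : ι → ℕ}

theorem norm_extend_le_one (z : ClosedBallLInf) {v : ι → ℂ} (hv : ∀ i, ‖v i‖ ≤ 1)
    (he : Function.Injective e) (n : ℕ) : ‖Function.extend e v z.1 n‖ ≤ 1 := by
  by_cases hn : ∃ i, e i = n
  · obtain ⟨i, rfl⟩ := hn
    rw [he.extend_apply]
    exact hv i
  · rw [Function.extend_apply' _ _ _ hn]
    exact z.norm_apply_le n

/-- The point obtained from `z` by replacing the coordinates in the range of `e` by those of `v`. -/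
def replaceCoord (z : ClosedBallLInf) (he : Function.Injective e) (v : ι → ℂ)
    (hv : ∀ i, ‖v i‖ ≤ 1) : ClosedBallLInf :=
  mk (Function.extend e v z.1) (z.norm_extend_le_one hv he)

variable (z : ClosedBallLInf) (he : Function.Injective e) (v : ι → ℂ) (hv : ∀ i, ‖v i‖ ≤ 1)

theorem replaceCoord_apply (i : ι) : (z.replaceCoord he v hv).1 (e i) = v i :=
  he.extend_apply v z.1 i

theorem replaceCoord_apply_of_notMem {n : ℕ} (hn : n ∉ range e) :
    (z.replaceCoord he v hv).1 n = z.1 n :=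
  Function.extend_apply' _ _ _ hn

end ClosedBallLInf

namespace IsCoordinateBall

variable {U ι B : Type*} [NormedRing B] [NormedAlgebra ℂ B] {val : U → ι → ℂ}
  {χ : U → characterSpace ℂ B} (H : IsCoordinateBall val χ) {e : ι → ℕ}
  (he : Function.Injective e) (z : ClosedBallLInf)

include H in
theorem exists_lt_one_forall_norm_le (u : U) : ∃ r < 1, ∀ i, ‖val u i‖ ≤ r :=
  H.range_val.le (mem_range_self u)

include H in
theorem norm_val_le_one (u : U) (i : ι) : ‖val u i‖ ≤ 1 := by
  obtain ⟨r, hr, hu⟩ := H.exists_lt_one_forall_norm_le u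
  exact (hu i).trans hr.le

/-- The embedding of the coordinate ball in the closed ball of `ℓ_∞` that replaces the coordinates
of `z` in the range of `e`. -/
def embed (u : U) : ClosedBallLInf := z.replaceCoord he (val u) (H.norm_val_le_one u)

theorem coe_embed (u : U) : ⇑(H.embed he z u).1 = Function.extend e (val u) z.1 := rfl

theorem injective_pointEval_embed : Function.Injective fun u => pointEval (H.embed he z u) := by
  intro u v huv
  refine H.injective_val (funext fun i => ?_)
  rw [← z.replaceCoord_apply he (val u) (H.norm_val_le_one u),
    ← z.replaceCoord_apply he (val v) (H.norm_val_le_one v)]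
  exact congrArg (fun w : ClosedBallLInf => w.1 (e i)) (pointEval_injective huv)

theorem exists_forall_apply_eq_embed (k : ℕ) :
    ∃ g : B, ∀ u, χ u g = (H.embed he z u).1 k := by
  by_cases hk : k ∈ range e
  · obtain ⟨i, rfl⟩ := hk
    simpa only [embed, ClosedBallLInf.replaceCoord_apply] using H.exists_apply_eq_val i
  · refine ⟨algebraMap ℂ B (z.1 k), fun u => ?_⟩
    rw [embed, z.replaceCoord_apply_of_notMem he _ _ hk, AlgHomClass.commutes (χ u),
      Algebra.algebraMap_self_apply]

theorem gleasonDist_pointEval_embed (u v : U) :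
    gleasonDist (pointEval (H.embed he z u)) (pointEval (H.embed he z v)) =
      gleasonDist (χ u) (χ v) := by
  refine le_antisymm (gleasonDist_le_of_dense (dense_coordPoly isCZeroBasis_unitVec) ?_)
    (gleasonDist_le_of_dense dense_univ fun g _ => ?_)
  · intro q hq
    obtain ⟨g, hg⟩ := exists_forall_apply_eq_of_mem_coordPoly
      (φ := fun u => pointEval (H.embed he z u))
      (by simpa only [charCoord_pointEval] using H.exists_forall_apply_eq_embed he z) hq
    refine ⟨g, H.norm_le g _ fun u => ?_, hg u, hg v⟩
    rw [hg]
    exact character_norm_apply_le _ q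
  · obtain ⟨f, hf, hfw⟩ := H.exists_lift e he g
    exact ⟨f, hf, hfw u _ (z.replaceCoord_apply he _ _), hfw v _ (z.replaceCoord_apply he _ _)⟩

theorem range_pointEval_embed_subset {r : ℝ} (hr : r < 1) (hz : ∀ i, ‖z.1 (e i)‖ ≤ r) :
    range (fun u => pointEval (H.embed he z u)) ⊆ gleasonPart (pointEval z) := by
  rintro _ ⟨u, rfl⟩
  obtain ⟨s, hs, hu⟩ := H.exists_lt_one_forall_norm_le u
  refine pointEval_mem_gleasonPart (max_lt hr hs) fun n => ?_
  by_cases hn : n ∈ range e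
  · obtain ⟨i, rfl⟩ := hn
    rw [embed, z.replaceCoord_apply]
    exact Or.inr ⟨(hz i).trans (le_max_left r s), (hu i).trans (le_max_right r s)⟩
  · exact Or.inl (z.replaceCoord_apply_of_notMem he _ _ hn)

theorem range_pointEval_embed (hez : range e = (unimodularIdx z)ᶜ) {r : ℝ} (hr : r < 1)
    (hz : ∀ n ∈ (unimodularIdx z)ᶜ, ‖z.1 n‖ ≤ r) :
    range (fun u => pointEval (H.embed he z u)) = gleasonPart (pointEval z) := by
  refine (H.range_pointEval_embed_subset he z hr fun i =>
    hz _ (hez ▸ mem_range_self i)).antisymm ?_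
  rw [gleasonPart_pointEval hr hz]
  rintro _ ⟨w, rfl, hwz, hw⟩
  simp only [← hez, forall_mem_range] at hw
  obtain ⟨u, hu⟩ := H.range_val.ge hw
  refine ⟨u, congrArg pointEval (ClosedBallLInf.ext fun n => ?_)⟩
  by_cases hn : n ∈ range e
  · obtain ⟨i, rfl⟩ := hn
    rw [embed, z.replaceCoord_apply, hu]
  · rw [embed, z.replaceCoord_apply_of_notMem he _ _ hn]
    exact (hwz n (not_not.1 fun h => hn (hez ▸ h))).symm

end IsCoordinateBall

end ReplaceCoord

section PerturbCoord

/-- The point `a` of the closed disc moved by a third of its distance to the unit circle in the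
direction `s`. Since the hyperbolic metric of the disc is comparable with the Euclidean metric
divided by that distance, this is Lipschitz in `s` uniformly in `a`. -/
def perturb (a s : ℂ) : ℂ := a + ((1 - ‖a‖ : ℝ) : ℂ) * (s / 3)

theorem perturb_zero (a : ℂ) : perturb a 0 = a := by
  rw [perturb, zero_div, mul_zero, add_zero]

theorem perturb_injective {a : ℂ} (ha : ‖a‖ < 1) : Function.Injective (perturb a) := fun _ _ h =>
  (div_left_inj' (three_ne_zero' ℂ)).1 <| mul_left_cancel₀
    (Complex.ofReal_ne_zero.2 (sub_pos.2 ha).ne') (add_left_cancel h)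

variable {a s t : ℂ} (ha : ‖a‖ ≤ 1)

include ha

theorem norm_one_sub_norm_mul (s : ℂ) :
    ‖((1 - ‖a‖ : ℝ) : ℂ) * (s / 3)‖ = (1 - ‖a‖) * (‖s‖ / 3) := by
  rw [norm_mul, norm_div, Complex.norm_real, Real.norm_of_nonneg (sub_nonneg.2 ha),
    Complex.norm_ofNat]

theorem norm_perturb_le (hs : ‖s‖ ≤ 1) : ‖perturb a s‖ ≤ 1 - 2 / 3 * (1 - ‖a‖) := by
  have h := norm_add_le a (((1 - ‖a‖ : ℝ) : ℂ) * (s / 3))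
  rw [norm_one_sub_norm_mul ha] at h
  rw [perturb]
  nlinarith

theorem norm_perturb_le_one (hs : ‖s‖ ≤ 1) : ‖perturb a s‖ ≤ 1 :=
  (norm_perturb_le ha hs).trans (by linarith)

theorem norm_perturb_sub_le (hs : ‖s‖ ≤ 1) (ht : ‖t‖ ≤ 1) :
    ‖perturb a s - perturb a t‖ ≤
      ‖s - t‖ / 2 * ‖1 - star (perturb a t) * perturb a s‖ := by
  have hsub : ‖perturb a s - perturb a t‖ = (1 - ‖a‖) * (‖s - t‖ / 3) := by
    rw [← norm_one_sub_norm_mul ha, perturb, perturb, add_sub_add_left_eq_sub, ← mul_sub, sub_div]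
  have hlower : 2 / 3 * (1 - ‖a‖) ≤ ‖1 - star (perturb a t) * perturb a s‖ := calc
    _ ≤ 1 - ‖perturb a s‖ := by linarith [norm_perturb_le ha hs]
    _ ≤ 1 - ‖perturb a t‖ * ‖perturb a s‖ := by
      gcongr
      exact mul_le_of_le_one_left (norm_nonneg _) (norm_perturb_le_one ha ht)
    _ ≤ _ := by
      simpa only [norm_one, norm_mul, norm_star] using
        norm_sub_norm_le 1 (star (perturb a t) * perturb a s)
  rw [hsub]
  calc (1 - ‖a‖) * (‖s - t‖ / 3) = ‖s - t‖ / 2 * (2 / 3 * (1 - ‖a‖)) := by ring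
    _ ≤ _ := by gcongr

end PerturbCoord

namespace ClosedBallLInf

variable {e : ℕ → ℕ} (z : ClosedBallLInf) (he : Function.Injective e)

/-- The point obtained from `z` by perturbing the coordinates in the range of `e` in the directions
given by the coordinates of `u`. -/
def perturbCoord (u : OpenBallLInf) : ClosedBallLInf :=
  z.replaceCoord he (fun j => perturb (z.1 (e j)) (u.1 j)) fun j =>
    norm_perturb_le_one (z.norm_apply_le (e j)) (u.toClosed.norm_apply_le j)

theorem perturbCoord_zero : z.perturbCoord he ⟨0, mem_ball_self one_pos⟩ = z := by
  refine ClosedBallLInf.ext fun n => ?_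
  by_cases hn : n ∈ range e
  · obtain ⟨j, rfl⟩ := hn
    rw [perturbCoord, replaceCoord_apply]
    exact perturb_zero _
  · exact z.replaceCoord_apply_of_notMem he _ _ hn

theorem perturbCoord_injective (hz : ∀ j, ‖z.1 (e j)‖ < 1) :
    Function.Injective (z.perturbCoord he) := by
  intro u v huv
  refine Subtype.ext (lp.ext (funext fun j => perturb_injective (hz j) ?_))
  have h := congrArg (fun w : ClosedBallLInf => w.1 (e j)) huv
  simpa only [perturbCoord, replaceCoord_apply] using h

theorem pseudoHyp_perturbCoord_le (u v : OpenBallLInf) :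
    pseudoHyp (pointEval (z.perturbCoord he u)) (pointEval (z.perturbCoord he v)) ≤
      ‖u.1 - v.1‖ / 2 := by
  refine (isCZeroBasis_unitVec.pseudoHyp_le_iff (by positivity)).2 fun n => ?_
  simp only [charCoord_pointEval, perturbCoord]
  by_cases hn : n ∈ range e
  · obtain ⟨j, rfl⟩ := hn
    simp only [replaceCoord_apply]
    refine (norm_perturb_sub_le (z.norm_apply_le (e j)) (u.toClosed.norm_apply_le j)
      (v.toClosed.norm_apply_le j)).trans ?_
    exact mul_le_mul_of_nonneg_right
      (div_le_div_of_nonneg_right (LInf.norm_apply_le (u.1 - v.1) j) zero_le_two) (norm_nonneg _)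
  · simp only [replaceCoord_apply_of_notMem _ _ _ _ hn, sub_self, norm_zero]
    positivity

theorem pointEval_perturbCoord_mem_gleasonPart (u : OpenBallLInf) :
    pointEval (z.perturbCoord he u) ∈ gleasonPart (pointEval z) := by
  have h := z.pseudoHyp_perturbCoord_le he ⟨0, mem_ball_self one_pos⟩ u
  rw [perturbCoord_zero, zero_sub, norm_neg] at h
  have hu : ‖u.1‖ < 1 := mem_ball_zero_iff.1 u.2
  exact h.trans_lt (by linarith)

theorem continuous_toDual_pointEval_perturbCoord :
    Continuous fun u => toDual (pointEval (z.perturbCoord he u)) := by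
  refine LipschitzWith.continuous (K := 1) (LipschitzWith.of_dist_le_mul fun u v => ?_)
  have h := (gleasonDist_le_two_mul_pseudoHyp _ _).trans
    (mul_le_mul_of_nonneg_left (z.pseudoHyp_perturbCoord_le he u v) zero_le_two)
  rw [mul_div_cancel₀ _ two_ne_zero] at h
  rwa [NNReal.coe_one, one_mul, dist_eq_norm, Subtype.dist_eq, dist_eq_norm]

end ClosedBallLInf

section Splitting

theorem exists_injective_range_eq_of_infinite {N : Set ℕ} (hN : N.Infinite) :
    ∃ e : ℕ → ℕ, Function.Injective e ∧ range e = N :=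
  ⟨Nat.nth (· ∈ N), Nat.nth_injective hN, Nat.range_nth_of_infinite hN⟩

theorem exists_injective_range_eq_of_encard_eq {α : Type*} {N : Set α} {k : ℕ}
    (hN : N.encard = k) : ∃ e : Fin k → α, Function.Injective e ∧ range e = N := by
  have := (finite_of_encard_eq_coe hN).to_subtype
  have hcard : Nat.card N = k := by rw [Nat.card_coe_set_eq, ncard, hN, ENat.toNat_natCast]
  let f : Fin k ≃ N := (Finite.equivFinOfCardEq hcard).symm
  exact ⟨_, Subtype.val_injective.comp f.injective, by
    rw [f.surjective.range_comp, Subtype.range_coe]⟩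

theorem exists_lt_one_forall_le {ι : Type*} [Finite ι] {f : ι → ℝ} (hf : ∀ i, f i < 1) :
    ∃ r < 1, ∀ i, f i ≤ r := by
  cases isEmpty_or_nonempty ι
  · exact ⟨0, one_pos, isEmptyElim⟩
  · obtain ⟨i, hi⟩ := Finite.exists_max f
    exact ⟨f i, hf i, hi⟩

theorem ClosedBallLInf.norm_apply_lt_one (z : ClosedBallLInf) {n : ℕ}
    (hn : n ∈ (unimodularIdx z)ᶜ) : ‖z.1 n‖ < 1 :=
  lt_of_le_of_ne (z.norm_apply_le n) hn

theorem infinite_compl_unimodularIdx {z : ClosedBallLInf}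
    (hz : ¬∃ r < 1, ∀ n ∈ (unimodularIdx z)ᶜ, ‖z.1 n‖ ≤ r) : (unimodularIdx z)ᶜ.Infinite := by
  intro hfin
  have := hfin.to_subtype
  obtain ⟨r, hr, h⟩ := exists_lt_one_forall_le fun n : ((unimodularIdx z)ᶜ : Set ℕ) =>
    z.norm_apply_lt_one n.2
  exact hz ⟨r, hr, fun n hn => h ⟨n, hn⟩⟩

theorem exists_isSplitting (z : ClosedBallLInf) :
    ∃ N₂ N₃ : Set ℕ, IsSplitting z N₂ N₃ ∧
      (N₂ = Set.univ ∨ unimodularIdx z = Set.univ ∨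
        (N₃ = ∅ ∧ (unimodularIdx z).Nonempty ∧ N₂.Nonempty) ∨
        (N₃.Infinite ∧ N₂ = ∅) ∨ (N₂.Infinite ∧ N₃.Infinite)) := by
  by_cases hz : ∃ r < 1, ∀ n ∈ (unimodularIdx z)ᶜ, ‖z.1 n‖ ≤ r
  · refine ⟨(unimodularIdx z)ᶜ, ∅, ⟨disjoint_bot_right, union_empty _, hz, fun h =>
      absurd h not_nonempty_empty⟩, ?_⟩
    rw [compl_univ_iff, nonempty_compl]
    have := (unimodularIdx z).eq_empty_or_nonempty
    tauto
  · refine ⟨∅, (unimodularIdx z)ᶜ, ⟨disjoint_bot_left, empty_union _, ⟨0, one_pos, by simp⟩,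
      fun _ => ⟨?_, fun b hb => ?_⟩⟩, .inr <| .inr <| .inr <| .inl
        ⟨infinite_compl_unimodularIdx hz, rfl⟩⟩
    · rintro _ ⟨n, -, rfl⟩
      exact z.norm_apply_le n
    · by_contra! hb1
      exact hz ⟨b, hb1, fun n hn => hb ⟨n, hn, rfl⟩⟩

namespace IsSplitting

variable {z : ClosedBallLInf} {N₂ N₃ : Set ℕ}

theorem norm_apply_lt_one (h : IsSplitting z N₂ N₃) {n : ℕ} (hn : n ∈ N₃) : ‖z.1 n‖ < 1 :=
  z.norm_apply_lt_one (h.union.le (.inr hn))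

theorem norm_lt_one (h : IsSplitting z univ N₃) : ‖z.1‖ < 1 := by
  obtain ⟨r, hr, hz⟩ := h.sup_lt
  exact (LInf.norm_le ((norm_nonneg _).trans (hz 0 trivial)) fun n => hz n trivial).trans_lt hr

end IsSplitting

end Splitting

section Classification

variable {z : ClosedBallLInf}

theorem gleasonPart_pointEval_of_norm_lt_one (hz : ‖z.1‖ < 1) :
    gleasonPart (pointEval z) = range fun w : OpenBallLInf => pointEval w.toClosed := by
  have hcompl : (unimodularIdx z)ᶜ = univ :=
    eq_univ_of_forall fun n => ((LInf.norm_apply_le z.1 n).trans_lt hz).ne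
  rw [← OpenBallLInf.isCoordinateBall.range_pointEval_embed Function.injective_id z
    (range_id.trans hcompl.symm) hz fun n _ => LInf.norm_apply_le z.1 n]
  congr! 3 with u
  exact ClosedBallLInf.ext fun n => z.replaceCoord_apply Function.injective_id _ _ n

theorem gleasonPart_pointEval_of_unimodularIdx_eq_univ (hz : unimodularIdx z = univ) :
    gleasonPart (pointEval z) = {pointEval z} := by
  rw [gleasonPart_pointEval zero_lt_one (by simp [hz]), hz]
  refine Subset.antisymm ?_ (singleton_subset_iff.2 ⟨z, rfl, fun _ _ => rfl, 0, one_pos, by simp⟩)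
  rintro _ ⟨w, rfl, hw, -⟩
  exact congrArg pointEval (ClosedBallLInf.ext fun n => hw n trivial)

theorem OpenBallLInf.injective_pointEval_toClosed :
    Function.Injective fun w : OpenBallLInf => pointEval w.toClosed := fun _ _ h =>
  Subtype.ext (congrArg (fun w : ClosedBallLInf => w.1) (pointEval_injective h))

namespace IsCoordinateBall

variable {U ι B : Type*} [NormedRing B] [NormedAlgebra ℂ B] {val : U → ι → ℂ}
  {χ : U → characterSpace ℂ B} (H : IsCoordinateBall val χ) {e : ι → ℕ}
  (he : Function.Injective e) {r : ℝ} (hr : r < 1)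

include H he hr

theorem exists_isometry_into_gleasonPart (hz : ∀ i, ‖z.1 (e i)‖ ≤ r) :
    ∃ F : U → ClosedBallLInf, (∀ u, ⇑(F u).1 = Function.extend e (val u) z.1) ∧
      Function.Injective (fun u => pointEval (F u)) ∧
      range (fun u => pointEval (F u)) ⊆ gleasonPart (pointEval z) ∧
      ∀ u v, gleasonDist (pointEval (F u)) (pointEval (F v)) = gleasonDist (χ u) (χ v) :=
  ⟨H.embed he z, H.coe_embed he z, H.injective_pointEval_embed he z,
    H.range_pointEval_embed_subset he z hr hz, H.gleasonDist_pointEval_embed he z⟩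

theorem exists_isometry_onto_gleasonPart (hez : range e = (unimodularIdx z)ᶜ)
    (hz : ∀ n ∈ (unimodularIdx z)ᶜ, ‖z.1 n‖ ≤ r) :
    ∃ F : U → ClosedBallLInf, (∀ u, ⇑(F u).1 = Function.extend e (val u) z.1) ∧
      Function.Injective (fun u => pointEval (F u)) ∧
      range (fun u => pointEval (F u)) = gleasonPart (pointEval z) ∧
      ∀ u v, gleasonDist (pointEval (F u)) (pointEval (F v)) = gleasonDist (χ u) (χ v) :=
  ⟨H.embed he z, H.coe_embed he z, H.injective_pointEval_embed he z,
    H.range_pointEval_embed he z hez hr hz, H.gleasonDist_pointEval_embed he z⟩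

end IsCoordinateBall

theorem ClosedBallLInf.exists_continuous_injective_gleasonPart {e : ℕ → ℕ}
    (he : Function.Injective e) (hz : ∀ j, ‖z.1 (e j)‖ < 1) :
    ∃ J : OpenBallLInf → SpecC0, Function.Injective J ∧ range J ⊆ gleasonPart (pointEval z) ∧
      Continuous fun u => toDual (J u) :=
  ⟨_, pointEval_injective.comp (z.perturbCoord_injective he hz),
    range_subset_iff.2 (z.pointEval_perturbCoord_mem_gleasonPart he),
    z.continuous_toDual_pointEval_perturbCoord he⟩

end Classification

theorem mainTheorem2 :
    ∃ δ : ClosedBallLInf → SpecC0, IsPointEvaluation δ ∧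
    ∀ z : ClosedBallLInf,
    -- the coordinates can be split so that one of the five cases below occurs
    (∃ N₂ N₃ : Set ℕ, IsSplitting z N₂ N₃ ∧
      (N₂ = Set.univ ∨ unimodularIdx z = Set.univ ∨
        (N₃ = ∅ ∧ (unimodularIdx z).Nonempty ∧ N₂.Nonempty) ∨
        (N₃.Infinite ∧ N₂ = ∅) ∨ (N₂.Infinite ∧ N₃.Infinite))) ∧
    ∀ N₂ N₃ : Set ℕ, IsSplitting z N₂ N₃ →
    -- (i)
    (N₂ = Set.univ →
      ‖z.1‖ < 1 ∧
      gleasonPart (δ z) = gleasonPart (δ ⟨0, Metric.mem_closedBall_self zero_le_one⟩) ∧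
      gleasonPart (δ z) = Set.range (fun w : OpenBallLInf => δ w.toClosed) ∧
      Function.Injective (fun w : OpenBallLInf => δ w.toClosed)) ∧
    -- (ii)
    (unimodularIdx z = Set.univ → (∀ n, ‖z.1 n‖ = 1) ∧ gleasonPart (δ z) = {δ z}) ∧
    -- (iii)
    (N₃ = ∅ → (unimodularIdx z).Nonempty → N₂.Nonempty →
      gleasonPart (δ z) = {φ | ∃ w : ClosedBallLInf, φ = δ w ∧
        (∀ n ∈ unimodularIdx z, w.1 n = z.1 n) ∧ ∃ r : ℝ, r < 1 ∧ ∀ n ∈ N₂, ‖w.1 n‖ ≤ r} ∧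
      (∀ k : ℕ, N₂.encard = k →
        ∃ (e : Fin k → ℕ) (F : Polydisc k → ClosedBallLInf),
          Function.Injective e ∧ Set.range e = N₂ ∧
          (∀ u, ⇑(F u).1 = Function.extend e u.1 (⇑z.1)) ∧
          Function.Injective (fun u => δ (F u)) ∧
          Set.range (fun u => δ (F u)) = gleasonPart (δ z) ∧
          ∀ u v, gleasonDist (δ (F u)) (δ (F v)) =
            gleasonDist (evalChar (Fin k → ℂ) u) (evalChar (Fin k → ℂ) v)) ∧
      (N₂.Infinite →
        ∃ (e : ℕ → ℕ) (F : OpenBallLInf → ClosedBallLInf),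
          Function.Injective e ∧ Set.range e = N₂ ∧
          (∀ u, ⇑(F u).1 = Function.extend e (⇑u.1) (⇑z.1)) ∧
          Function.Injective (fun u => δ (F u)) ∧
          Set.range (fun u => δ (F u)) = gleasonPart (δ z) ∧
          ∀ u v, gleasonDist (δ (F u)) (δ (F v)) =
            gleasonDist (δ u.toClosed) (δ v.toClosed))) ∧
    -- (iv)
    (N₃.Infinite → N₂ = ∅ →
      (∀ k : ℕ,
        ∃ (e : Fin k → ℕ) (F : Polydisc k → ClosedBallLInf),
          Function.Injective e ∧ Set.range e ⊆ N₃ ∧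
          (∀ u, ⇑(F u).1 = Function.extend e u.1 (⇑z.1)) ∧
          Function.Injective (fun u => δ (F u)) ∧
          Set.range (fun u => δ (F u)) ⊆ gleasonPart (δ z) ∧
          ∀ u v, gleasonDist (δ (F u)) (δ (F v)) =
            gleasonDist (evalChar (Fin k → ℂ) u) (evalChar (Fin k → ℂ) v)) ∧
      ∃ J : OpenBallLInf → SpecC0,
        Function.Injective J ∧ Set.range J ⊆ gleasonPart (δ z) ∧
        Continuous (fun u => toDual (J u))) ∧
    -- (v)
    (N₂.Infinite → N₃.Infinite →
      ∃ (e : ℕ → ℕ) (F : OpenBallLInf → ClosedBallLInf),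
        Function.Injective e ∧ Set.range e = N₂ ∧
        (∀ u, ⇑(F u).1 = Function.extend e (⇑u.1) (⇑z.1)) ∧
        Function.Injective (fun u => δ (F u)) ∧
        Set.range (fun u => δ (F u)) ⊆ gleasonPart (δ z) ∧
        ∀ u v, gleasonDist (δ (F u)) (δ (F v)) =
          gleasonDist (δ u.toClosed) (δ v.toClosed)) := by
  refine ⟨pointEval, isPointEvaluation_pointEval, fun z => ⟨exists_isSplitting z,
    fun N₂ N₃ hS => ⟨?_, ?_, ?_, ?_, ?_⟩⟩⟩
  · rintro rfl
    have hpart := gleasonPart_pointEval_of_norm_lt_one hS.norm_lt_one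
    have hpart₀ := gleasonPart_pointEval_of_norm_lt_one
      (z := ⟨0, mem_closedBall_self zero_le_one⟩) (norm_zero.trans_lt one_pos)
    exact ⟨hS.norm_lt_one, hpart.trans hpart₀.symm, hpart,
      OpenBallLInf.injective_pointEval_toClosed⟩
  · exact fun h₁ =>
      ⟨fun n => h₁.ge (mem_univ n), gleasonPart_pointEval_of_unimodularIdx_eq_univ h₁⟩
  · rintro rfl - -
    obtain rfl : N₂ = (unimodularIdx z)ᶜ := (union_empty N₂).symm.trans hS.union
    obtain ⟨r, hr, hz⟩ := hS.sup_lt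
    refine ⟨gleasonPart_pointEval hr hz, fun k hk => ?_, fun hinf => ?_⟩
    · obtain ⟨e, he, heN⟩ := exists_injective_range_eq_of_encard_eq hk
      obtain ⟨F, hF⟩ := Polydisc.isCoordinateBall.exists_isometry_onto_gleasonPart he hr heN hz
      exact ⟨e, F, he, heN, hF⟩
    · obtain ⟨e, he, heN⟩ := exists_injective_range_eq_of_infinite hinf
      obtain ⟨F, hF⟩ := OpenBallLInf.isCoordinateBall.exists_isometry_onto_gleasonPart he hr heN hz
      exact ⟨e, F, he, heN, hF⟩
  · rintro hinf -
    obtain ⟨e, he, rfl⟩ := exists_injective_range_eq_of_infinite hinf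
    have hz (j : ℕ) : ‖z.1 (e j)‖ < 1 := hS.norm_apply_lt_one (mem_range_self j)
    refine ⟨fun k => ?_, z.exists_continuous_injective_gleasonPart he hz⟩
    have he' := he.comp (Fin.val_injective (n := k))
    obtain ⟨r, hr, hzr⟩ := exists_lt_one_forall_le fun i : Fin k => hz i
    obtain ⟨F, hF⟩ := Polydisc.isCoordinateBall.exists_isometry_into_gleasonPart he' hr hzr
    exact ⟨_, F, he', range_comp_subset_range _ e, hF⟩
  · rintro hinf -
    obtain ⟨r, hr, hz⟩ := hS.sup_lt
    obtain ⟨e, he, rfl⟩ := exists_injective_range_eq_of_infinite hinf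
    obtain ⟨F, hF⟩ := OpenBallLInf.isCoordinateBall.exists_isometry_into_gleasonPart he hr
      fun j => hz _ (mem_range_self j)
    exact ⟨e, F, he, rfl, hF⟩

end
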